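/- **Setting.** Let $1\le m\le n$ be integers, $\Omega\subset\mathbf R^{n+1}$ a bounded domain (open, connected, non-empty) of class $C^2$ with boundary $S=\partial\Omega$ and inwards pointing unit normal $\nu^S$. Let $\beta\in C^1(S,(0,\pi))$. Let $G(m,n+1)$ be the Grassmannian of unoriented $m$-planes of $\mathbf R^{n+1}$, and write $P(v)$, $T_xS(v)$ for the orthogonal projection of a vector $v$ onto the plane $P$, resp. onto the tangent space $T_xS$. Let $B_r(x)$ denote the closed ball, and $\omega_m$ the volume of the unit ball of $\mathbf R^m$. Fix $\rho_S>0$ such that $(x,t)\mapsto x+t\,\nu^S(x)$ is a diffeomorphism from $S\times[0,\rho_S)$ onto $\{y\in\overline\Omega:\operatorname{dist}(y,S)<\rho_S\}$. The capillary bundle $G_{m,\beta}(S)$ is the set of all $(x,P)\in S\times G(m,n+1)$ with $|P(\nu^S(x))|=\sin\beta(x)$ and $(P\cap T_xS)\perp P(\nu^S(x))$; on it put $\mathbf n(x,P)=P(\nu^S(x))/|P(\nu^S(x))|$. Let $V$ be an $m$-varifold on $\overline\Omega$, that is, a Radon measure on $\overline\Omega\times G(m,n+1)$, with weight measure $\mu_V$,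 and let $\Gamma$ be a Radon measure on $G_{m,\beta}(S)$. Then $V$ is a *varifold with capillary boundary*, $V\in\mathbf V^m_\beta(\Omega)$, with *boundary varifold* $\Gamma$ and *generalized mean curvature* $\mathbf H\in L^1(\mu_V)$ if $\mathbf H(x)\in T_xS$ for $\mu_V$-a.e. $x\in S$, and $$\int \operatorname{div}_P\varphi(x)\,dV(x,P)=-\int_{\overline\Omega}\langle\mathbf H,\varphi\rangle\,d\mu_V-\int_{G_{m,\beta}(S)}\langle\mathbf n(x,P),\varphi(x)\rangle\,d\Gamma(x,P)$$ for all $\varphi\in C^1(\overline\Omega,\mathbf R^{n+1})$ with $\varphi(x)\in T_xS$ for every $x\in S$. Disintegrate $\Gamma=\sigma_\Gamma\otimes\Gamma^x$, where $\sigma_\Gamma$ is the push-forward of $\Gamma$ to $S$ and the $\Gamma^x$ are probability measures. Put $\mathbf n_V(x)=\int\mathbf n(x,P)\,d\Gamma^x(P)$ and $\mathbf n_W(x)=T_xS(\mathbf n_V(x))/\cos\beta(x)$ (at points with $\cos\beta(x)=0$, where $T_xS(\mathbf n_V(x))=0$, $\cos\beta(x)\,\mathbf n_W(x)$ is read as $0$).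 A point $x_0\in\operatorname{spt}\sigma_\Gamma\cap\{x\in S:\cos\beta(x)\ne0\}$ is a *capillary boundary point* with factors $\epsilon_0,\rho_0\in(0,1]$, $c_0>0$ and a unit vector $\tau\in T_{x_0}S$ if for $\sigma_\Gamma$-a.e. $x\in B_{\rho_0}(x_0)$ $$\langle\cos\beta(x)\mathbf n_W(x),\tau\rangle\ge\epsilon_0,\qquad |\langle x-x_0,\cos\beta(x)\mathbf n_W(x)\rangle|\le c_0|\cos\beta(x_0)||x-x_0|^2 .$$ **Statement.** Let $V\in\mathbf V^m_\beta(\Omega)$ with boundary varifold $\Gamma$ and $\mathbf H\in L^p(\mu_V)$ for some $p\in(m,\infty)$, and let $x_0$ be a capillary boundary point with factors $\epsilon_0,\rho_0,c_0,\tau$. Put $R=\min\{\rho_0,\rho_S/2\}$. 1. There is $\Lambda>0$, depending only on $m,p,S,\|\mathbf H\|_{L^p(\mu_V)},\epsilon_0,c_0,\cos\beta(x_0)$, such that the function $$\rho\mapsto e^{\Lambda\rho}\left(\left(\frac{\mu_V(B_\rho(x_0))}{\rho^m}\right)^{1/p}+\Lambda\rho^{\frac{p-m}p}\right)$$ has a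 finite limit as $\rho\searrow0$ and, with this limit as its value at $\rho=0$, is monotone increasing on $[0,R)$. 2. There is an increasing function $g_{x_0}:(0,\infty)\to(0,\infty)$ with $\lim_{\rho\searrow0}g_{x_0}(\rho)=0$ such that for all $0<r<\rho<R$ $$\frac{\mu_V(B_r(x_0))}{r^m}\le\frac{\mu_V(B_\rho(x_0))}{\rho^m}+g_{x_0}(\rho).$$ 3. The density $\Theta^m(\mu_V,x_0)=\lim_{r\searrow0}\frac{\mu_V(B_r(x_0))}{\omega_mr^m}$ exists as a finite number. Here "increasing" means non-decreasing. -/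

import Mathlib

open MeasureTheory ProbabilityTheory Filter Topology Set

noncomputable section

namespace Capillary

/-- The ambient Euclidean space of dimension `n + 1`. -/
abbrev Space (n : ℕ) : Type := EuclideanSpace ℝ (Fin (n + 1))

/-- The Grassmannian `G(m, n+1)` of unoriented `m`-planes. As usual for varifolds, a plane is
identified with the orthogonal projection onto it; the topology and the Borel sets are those
induced by the operator norm. Thus `P.1 v` is the projection of `v` onto the plane `P`, and
`P.1.range` is the plane itself. -/
abbrev Grass (m n : ℕ) : Type :=
  {P : Space n →L[ℝ] Space n // IsStarProjection P ∧ Module.finrank ℝ P.range = m}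

/-- A bounded domain (non-empty connected open set) of class `C²`: near each of its boundary
points it is the set where a `C²` function with non-vanishing differential is positive. -/
structure IsBoundedC2Domain {n : ℕ} (Ω : Set (Space n)) : Prop where
  isOpen : IsOpen Ω
  isConnected : IsConnected Ω
  isBounded : Bornology.IsBounded Ω
  boundary : ∀ x ∈ frontier Ω, ∃ (U : Set (Space n)) (f : Space n → ℝ),
    IsOpen U ∧ x ∈ U ∧ ContDiffOn ℝ 2 f U ∧ fderiv ℝ f x ≠ 0 ∧
      ∀ y ∈ U, (y ∈ Ω ↔ 0 < f y)

/-- `v` is the inwards pointing unit normal to `∂Ω` at `x`: directions in the open half-space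
`⟪w, v⟫ > 0` enter `Ω` and directions in the opposite open half-space leave it. -/
def IsInnerNormal {n : ℕ} (Ω : Set (Space n)) (x v : Space n) : Prop :=
  ‖v‖ = 1 ∧
  (∀ w : Space n, 0 < inner ℝ w v → ∀ᶠ t : ℝ in 𝓝[>] 0, x + t • w ∈ Ω) ∧
  (∀ w : Space n, inner ℝ w v < 0 → ∀ᶠ t : ℝ in 𝓝[>] 0, x + t • w ∉ closure Ω)

/-- The inwards pointing unit normal `ν^S(x)` along `S = ∂Ω`. -/
def innerNormal {n : ℕ} (Ω : Set (Space n)) (x : Space n) : Space n :=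
  Classical.epsilon (IsInnerNormal Ω x)

/-- Membership in the tangent space `T_x S` of `S = ∂Ω`, the orthogonal complement of the
normal. -/
def IsTangent {n : ℕ} (Ω : Set (Space n)) (x v : Space n) : Prop :=
  inner ℝ v (innerNormal Ω x) = 0

/-- The orthogonal projection of `v` onto `T_x S`. -/
def tangentProj {n : ℕ} (Ω : Set (Space n)) (x v : Space n) : Space n :=
  v - (inner ℝ v (innerNormal Ω x)) • innerNormal Ω x

/-- The one-sided tubular neighbourhood `{y ∈ closure Ω : dist(y, S) < ρ}` of `S = ∂Ω`. -/
def oneSidedTube {n : ℕ} (Ω : Set (Space n)) (ρ : ℝ) : Set (Space n) :=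
  {y | y ∈ closure Ω ∧ Metric.infDist y (frontier Ω) < ρ}

/-- The normal exponential map `(x, t) ↦ x + t ν^S(x)`. -/
def normalExp {n : ℕ} (Ω : Set (Space n)) (q : Space n × ℝ) : Space n :=
  q.1 + q.2 • innerNormal Ω q.1

/-- `ρS > 0` is such that the normal exponential map is a (`C¹`) diffeomorphism from
`S × [0, ρS)` onto the one-sided tubular neighbourhood of width `ρS`. -/
structure IsTubeRadius {n : ℕ} (Ω : Set (Space n)) (ρS : ℝ) : Prop where
  pos : 0 < ρS
  bijOn : Set.BijOn (normalExp Ω) (frontier Ω ×ˢ Set.Ico 0 ρS) (oneSidedTube Ω ρS)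
  contDiffOn : ContDiffOn ℝ 1 (normalExp Ω) (frontier Ω ×ˢ Set.Ico 0 ρS)
  contDiffOn_inv : ∃ ψ : Space n → Space n × ℝ, ContDiffOn ℝ 1 ψ (oneSidedTube Ω ρS) ∧
    ∀ q ∈ frontier Ω ×ˢ Set.Ico 0 ρS, ψ (normalExp Ω q) = q

/-- A contact angle function `β ∈ C¹(S, (0, π))` on `S = ∂Ω` (only its values on `S` matter).
On the `C²` hypersurface `S`, being `C¹` within the set `S` is the same as being `C¹` in
charts of `S`. -/
def IsContactAngle {n : ℕ} (Ω : Set (Space n)) (β : Space n → ℝ) : Prop :=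
  ContDiffOn ℝ 1 β (frontier Ω) ∧ ∀ x ∈ frontier Ω, β x ∈ Set.Ioo 0 Real.pi

/-- The capillary bundle `G_{m,β}(S)`: pairs `(x, P)` with `x ∈ S`, `|P(ν^S(x))| = sin β(x)` and
`P ∩ T_x S ⟂ P(ν^S(x))`. -/
def capillaryBundle {n : ℕ} (m : ℕ) (Ω : Set (Space n)) (β : Space n → ℝ) :
    Set (Space n × Grass m n) :=
  {q | q.1 ∈ frontier Ω ∧ ‖q.2.1 (innerNormal Ω q.1)‖ = Real.sin (β q.1) ∧
    ∀ w ∈ q.2.1.range, IsTangent Ω q.1 w → inner ℝ w (q.2.1 (innerNormal Ω q.1)) = 0}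

/-- The unit vector `𝐧(x, P) = P(ν^S(x)) / |P(ν^S(x))|`. -/
def planeConormal {m n : ℕ} (Ω : Set (Space n)) (x : Space n) (P : Grass m n) : Space n :=
  ‖P.1 (innerNormal Ω x)‖⁻¹ • P.1 (innerNormal Ω x)

/-- The divergence `div_P` along the plane `P` of a vector field whose differential is `A`: the
trace of `P ∘ A`, that is the sum of `⟪A eᵢ, eᵢ⟫` over an orthonormal basis of the plane. -/
def planeDiv {m n : ℕ} (P : Grass m n) (A : Space n →L[ℝ] Space n) : ℝ :=
  LinearMap.trace ℝ (Space n) ((P.1 ∘L A : Space n →L[ℝ] Space n) : Space n →ₗ[ℝ] Space n)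

/-- The first variation `δV(φ) = ∫ div_P φ(x) dV(x, P)` of a varifold `V` on `closure Ω`, for
`φ ∈ C¹(closure Ω, ℝⁿ⁺¹)`. -/
def firstVariation {m n : ℕ} (Ω : Set (Space n)) (V : Measure (Space n × Grass m n))
    (φ : Space n → Space n) : ℝ :=
  ∫ q, planeDiv q.2 (fderivWithin ℝ φ (closure Ω) q.1) ∂V

/-- For a bounded domain `Ω`: `V` is an `m`-varifold on `closure Ω` with capillary boundary, that
is `V` belongs to `𝐕^m_β(Ω)`, with boundary varifold `Γ` and generalized mean curvature vector
`H`. As `closure Ω × G(m, n+1)` and `G_{m,β}(S)` are compact, Radon measures on them are the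
finite Borel measures, and `L¹_loc(μ_V)` is `L¹(μ_V)`. The weight measure `μ_V` is `V.fst`. -/
structure IsCapillaryVarifold {m n : ℕ} (Ω : Set (Space n)) (β : Space n → ℝ)
    (V Γ : Measure (Space n × Grass m n)) (H : Space n → Space n) : Prop where
  finite_varifold : IsFiniteMeasure V
  varifold_on : V.fst (closure Ω)ᶜ = 0
  finite_boundary : IsFiniteMeasure Γ
  boundary_on : Γ (capillaryBundle m Ω β)ᶜ = 0
  integrable_curvature : Integrable H V.fst
  tangent_curvature : ∀ᵐ x ∂V.fst, x ∈ frontier Ω → IsTangent Ω x (H x)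
  first_variation : ∀ φ : Space n → Space n, ContDiffOn ℝ 1 φ (closure Ω) →
    (∀ x ∈ frontier Ω, IsTangent Ω x (φ x)) →
    firstVariation Ω V φ =
      -(∫ x, inner ℝ (H x) (φ x) ∂V.fst)
        - ∫ q, inner ℝ (planeConormal Ω q.1 q.2) (φ q.1) ∂Γ

/-- The generalized inwards pointing co-normal `𝐧_V(x) = ∫ 𝐧(x, P) dΓ^x(P)`, where `κ x = Γ^x` is
the disintegration of `Γ`. -/
def conormal {m n : ℕ} (Ω : Set (Space n)) (κ : Kernel (Space n) (Grass m n))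
    (x : Space n) : Space n :=
  ∫ P, planeConormal Ω x P ∂(κ x)

/-- The generalized inwards pointing co-normal with respect to `S`,
`𝐧_W(x) = T_x S(𝐧_V(x)) / cos β(x)`. -/
def boundaryConormal {m n : ℕ} (Ω : Set (Space n)) (β : Space n → ℝ)
    (κ : Kernel (Space n) (Grass m n)) (x : Space n) : Space n :=
  (Real.cos (β x))⁻¹ • tangentProj Ω x (conormal Ω κ x)

/-- `x₀` is a capillary boundary point, with corresponding factors: the unit vector
`τ ∈ T_{x₀} S`, `ε, ρ₀ ∈ (0, 1]` and `c > 0`. The generalized boundary measure `σ_Γ` is `Γ.fst`,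
and `κ` is the (almost everywhere unique) disintegration `Γ = σ_Γ ⊗ Γ^x` of `Γ`. -/
structure IsCapillaryPoint {m n : ℕ} (Ω : Set (Space n)) (β : Space n → ℝ)
    (Γ : Measure (Space n × Grass m n)) (x₀ τ : Space n) (ε c ρ₀ : ℝ) : Prop where
  mem_boundary : x₀ ∈ frontier Ω
  cos_ne_zero : Real.cos (β x₀) ≠ 0
  mem_support : x₀ ∈ Γ.fst.support
  norm_direction : ‖τ‖ = 1
  tangent_direction : IsTangent Ω x₀ τ
  eps_mem : ε ∈ Set.Ioc 0 1
  radius_mem : ρ₀ ∈ Set.Ioc 0 1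
  const_pos : 0 < c
  conditions : ∃ κ : Kernel (Space n) (Grass m n), IsMarkovKernel κ ∧ Γ.fst.compProd κ = Γ ∧
    (∀ᵐ x ∂Γ.fst, x ∈ Metric.closedBall x₀ ρ₀ →
      ε ≤ inner ℝ (Real.cos (β x) • boundaryConormal Ω β κ x) τ) ∧
    (∀ᵐ x ∂Γ.fst, x ∈ Metric.closedBall x₀ ρ₀ →
      |inner ℝ (x - x₀) (Real.cos (β x) • boundaryConormal Ω β κ x)|
        ≤ c * |Real.cos (β x₀)| * ‖x - x₀‖ ^ 2)

/-- The ratio `μ_V(B_ρ(x₀)) / ρ^m`, with `B_ρ(x₀)` the closed ball. -/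
def massRatio {m n : ℕ} (V : Measure (Space n × Grass m n)) (x₀ : Space n) (ρ : ℝ) : ℝ :=
  V.fst.real (Metric.closedBall x₀ ρ) / ρ ^ m

/-- The volume `ω_m` of the unit ball of `ℝ^m`. -/
def unitBallVolume (m : ℕ) : ℝ :=
  (volume : Measure (EuclideanSpace ℝ (Fin m))).real (Metric.closedBall 0 1)

/-- `e^{Λρ} ((μ_V(B_ρ(x₀)) / ρ^m)^{1/p} + Λ ρ^{(p-m)/p})`. -/
def monotoneQuantity {m n : ℕ} (V : Measure (Space n × Grass m n)) (x₀ : Space n)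
    (p Λ : ℝ) (ρ : ℝ) : ℝ :=
  Real.exp (Λ * ρ) * ((massRatio V x₀ ρ) ^ (1 / p) + Λ * ρ ^ ((p - m) / p))

end Capillary

end

/-! The proof tests the first variation with a cut-off radial field that is bent to be tangential
along `S` and to make the boundary term favourable.

Let `ξ` be the nearest point projection of the one-sided tube onto `S`, and `N = ν^S ∘ ξ`. The field
is `η(|x - x₀|²/ρ²) (x - x₀ + Z)`. On `S`, `x - x₀ + Z` is the tangential part of `x - x₀ + kρ²τ`.
Its product with `𝐧_V` is therefore the product of `cos β 𝐧_W` with `x - x₀ + kρ²τ`. The two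
capillary conditions bound this below by `kρ²ε₀ - c₀|cos β(x₀)||x - x₀|²`, which is non-negative on
the support of `η` for `k = 2c₀|cos β(x₀)|/ε₀`. So the boundary integral has a sign and can be
dropped, without any bound on the mass of `Γ`.

The price is small. Since `S` is `C²`, `⟨y - x₀, ν^S(y)⟩` is quadratic in `|y - x₀|` on `S`
(`exists_inner_normal_le`), hence `|Z| ≤ Bρ²` and `|DZ| ≤ Bρ` on the support. With `I(ρ)` the
smoothed mass, the first variation formula and Hölder's inequality give `ρI' - mI ≥ -(n + 1 + m)BρI
- (2 + B)‖H‖_p ρ I^(1 - 1/p)`. This bounds the derivative of `(I/ρ^m)^(1/p)` from below, and the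
factor `e^{Λρ}` and the summand `Λρ^((p-m)/p)` absorb the errors
(`weightedRatio_le_of_differential_inequality`). Letting `η` tend to the indicator of `(-∞, 1]`
replaces `I` by the mass of the closed ball (`monotoneQuantity_le`).

A non-negative monotone function has a limit at `0`. The almost monotonicity and the density follow
by taking `p`-th powers, the mass ratio being bounded by monotonicity. -/

namespace Capillary

/-! ### The unit normal of a `C²` boundary -/

section InnerNormal

variable {n : ℕ} {Ω : Set (Space n)}

/-- For distinct unit vectors, `w = u - v` has positive product with `u` and negative product with
`v`. This gives uniqueness of the inner normal, and later identifies the direction to a nearest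
boundary point. -/
theorem eq_of_forall_inner_nonneg {u v : Space n} (hu : ‖u‖ = 1) (hv : ‖v‖ = 1)
    (h : ∀ w : Space n, 0 < inner ℝ w u → 0 ≤ inner ℝ w v) : u = v := by
  by_contra hne
  have h1 : inner ℝ u v < 1 := (inner_lt_one_iff_real_of_norm_eq_one hu hv).2 hne
  have h2 := h (u - v) (by
    rw [inner_sub_left, real_inner_self_eq_norm_sq, hu, real_inner_comm]
    linarith)
  rw [inner_sub_left, real_inner_self_eq_norm_sq, hv] at h2
  linarith

theorem IsInnerNormal.eq {x u v : Space n} (hu : IsInnerNormal Ω x u)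
    (hv : IsInnerNormal Ω x v) : u = v := by
  refine eq_of_forall_inner_nonneg hu.1 hv.1 fun w hw => ?_
  by_contra hlt
  obtain ⟨t, h1, h2⟩ := ((hu.2.1 w hw).and (hv.2.2 w (not_le.1 hlt))).exists
  exact h2 (subset_closure h1)

theorem IsInnerNormal.innerNormal {x v : Space n} (hv : IsInnerNormal Ω x v) :
    IsInnerNormal Ω x (innerNormal Ω x) :=
  Classical.epsilon_spec (p := IsInnerNormal Ω x) ⟨v, hv⟩

theorem eventually_pos_of_fderiv_pos {f : Space n → ℝ} {x w : Space n}
    (hf : DifferentiableAt ℝ f x) (h0 : f x = 0) (hw : 0 < fderiv ℝ f x w) :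
    ∀ᶠ t : ℝ in 𝓝[>] 0, 0 < f (x + t • w) := by
  have h1 : HasDerivAt (fun t : ℝ => f (x + t • w)) (fderiv ℝ f x w) 0 := by
    have h2 : HasDerivAt (fun t : ℝ => x + t • w) w 0 := by
      simpa using ((hasDerivAt_id (0 : ℝ)).smul_const w).const_add x
    have h3 : HasFDerivAt f (fderiv ℝ f x) (x + (0 : ℝ) • w) := by simpa using hf.hasFDerivAt
    exact h3.comp_hasDerivAt (0 : ℝ) h2
  have h4 := hasDerivAt_iff_tendsto_slope.1 h1
  have h5 := (h4.eventually (lt_mem_nhds hw)).filter_mono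
    (nhdsWithin_mono (0 : ℝ) (fun t (ht : 0 < t) => ne_of_gt ht))
  filter_upwards [h5, self_mem_nhdsWithin] with t ht ht0
  simp only [slope_def_field, zero_smul, add_zero, h0, sub_zero] at ht
  exact (div_pos_iff_of_pos_right ht0).1 ht

/-- By continuity the differential of the defining function stays non-zero on a neighbourhood, so
one chart describes the normal at all nearby boundary points as a normalized gradient; this is where
its `C¹` regularity comes from. -/
theorem boundary_chart (hΩ : IsBoundedC2Domain Ω) {x : Space n} (hx : x ∈ frontier Ω) :
    ∃ (U : Set (Space n)) (f : Space n → ℝ), IsOpen U ∧ x ∈ U ∧ ContDiffOn ℝ 2 f U ∧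
      (∀ y ∈ U, gradient f y ≠ 0) ∧ ∀ y ∈ U, y ∈ frontier Ω → f y = 0 ∧
        innerNormal Ω y = ‖gradient f y‖⁻¹ • gradient f y ∧
        IsInnerNormal Ω y (innerNormal Ω y) := by
  obtain ⟨U, f, hU, hxU, hf, hfx, hfU⟩ := hΩ.boundary x hx
  have hc : ContinuousOn (fun y => fderiv ℝ f y) U :=
    hf.continuousOn_fderiv_of_isOpen hU (by norm_num)
  refine ⟨U ∩ {y | fderiv ℝ f y ≠ 0}, f, ?_, ⟨hxU, hfx⟩, hf.mono inter_subset_left, ?_, ?_⟩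
  · exact hc.isOpen_inter_preimage hU isOpen_compl_singleton
  · rintro y ⟨-, hy⟩
    simpa [gradient] using hy
  · rintro y ⟨hyU, hy0⟩ hyS
    have hd : DifferentiableAt ℝ f y :=
      (hf.contDiffAt (hU.mem_nhds hyU)).differentiableAt (by norm_num)
    have hyΩ : y ∉ Ω := by
      have := hyS.2
      rwa [hΩ.isOpen.interior_eq] at this
    have hfy : f y = 0 := by
      refine le_antisymm (not_lt.1 fun h => hyΩ ((hfU y hyU).2 h)) ?_
      by_contra hlt
      have h1 : ∀ᶠ z in 𝓝 y, f z < 0 := hd.continuousAt.eventually (gt_mem_nhds (not_le.1 hlt))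
      have h2 : ∃ᶠ z in 𝓝 y, z ∈ Ω := mem_closure_iff_frequently.1 hyS.1
      obtain ⟨z, hz, hz1, hz2⟩ := (h2.and_eventually (h1.and (hU.mem_nhds hyU))).exists
      exact absurd ((hfU z hz2).1 hz) (not_lt.2 hz1.le)
    have hg : gradient f y ≠ 0 := by simpa [gradient] using hy0
    have hin : ∀ w, inner ℝ w (‖gradient f y‖⁻¹ • gradient f y)
        = ‖gradient f y‖⁻¹ * fderiv ℝ f y w := by
      intro w
      rw [inner_smul_right, real_inner_comm]
      simp [gradient]
    have hgp : 0 < ‖gradient f y‖⁻¹ := by positivity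
    have hlim : ∀ w, Tendsto (fun t : ℝ => y + t • w) (𝓝[>] 0) (𝓝 y) := by
      intro w
      have : Continuous (fun t : ℝ => y + t • w) := by fun_prop
      simpa using (this.tendsto 0).mono_left nhdsWithin_le_nhds
    have key : IsInnerNormal Ω y (‖gradient f y‖⁻¹ • gradient f y) := by
      refine ⟨by simp [norm_smul, hg], fun w hw => ?_, fun w hw => ?_⟩
      · rw [hin] at hw
        have hw' := pos_of_mul_pos_right hw hgp.le
        filter_upwards [eventually_pos_of_fderiv_pos hd hfy hw',
          (hlim w).eventually (hU.mem_nhds hyU)] with t h1 h2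
        exact (hfU _ h2).2 h1
      · rw [hin] at hw
        have hw' : 0 < fderiv ℝ (fun z => - f z) y w := by
          rw [fderiv_fun_neg]
          simp only [neg_apply]
          nlinarith
        filter_upwards [eventually_pos_of_fderiv_pos hd.neg (by simp [hfy]) hw',
          (hlim w).eventually (hU.mem_nhds hyU)] with t h1 h2 hcl
        have hd' : ContinuousAt f (y + t • w) :=
          (hf.contDiffAt (hU.mem_nhds h2)).continuousAt
        have h3 : ∀ᶠ z in 𝓝 (y + t • w), f z < 0 :=
          hd'.eventually (gt_mem_nhds (by simpa using h1))
        obtain ⟨z, hz, hz1, hz2⟩ :=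
          ((mem_closure_iff_frequently.1 hcl).and_eventually (h3.and (hU.mem_nhds h2))).exists
        exact absurd ((hfU z hz2).1 hz) (not_lt.2 hz1.le)
    exact ⟨hfy, key.innerNormal.eq key, key.innerNormal⟩

theorem isInnerNormal_innerNormal (hΩ : IsBoundedC2Domain Ω) {x : Space n}
    (hx : x ∈ frontier Ω) : IsInnerNormal Ω x (innerNormal Ω x) := by
  obtain ⟨U, f, -, hxU, -, -, h⟩ := boundary_chart hΩ hx
  exact (h x hxU hx).2.2

theorem norm_innerNormal (hΩ : IsBoundedC2Domain Ω) {x : Space n}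
    (hx : x ∈ frontier Ω) : ‖innerNormal Ω x‖ = 1 :=
  (isInnerNormal_innerNormal hΩ hx).1

theorem contDiffOn_gradient {U : Set (Space n)} {f : Space n → ℝ} (hU : IsOpen U)
    (hf : ContDiffOn ℝ 2 f U) : ContDiffOn ℝ 1 (gradient f) U := by
  have h1 : ContDiffOn ℝ 1 (fderiv ℝ f) U := hf.fderiv_of_isOpen hU (by norm_num)
  exact (InnerProductSpace.toDual ℝ (Space n)).symm.contDiff.comp_contDiffOn h1

theorem contDiffOn_innerNormal (hΩ : IsBoundedC2Domain Ω) :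
    ContDiffOn ℝ 1 (innerNormal Ω) (frontier Ω) := by
  intro x hx
  obtain ⟨U, f, hU, hxU, hf, hg, h⟩ := boundary_chart hΩ hx
  have h1 : ContDiffOn ℝ 1 (fun y => ‖gradient f y‖⁻¹ • gradient f y) U := by
    have h2 := contDiffOn_gradient hU hf
    exact ((h2.norm ℝ hg).inv fun y hy => norm_ne_zero_iff.2 (hg y hy)).smul h2
  have h3 : ContDiffWithinAt ℝ 1 (innerNormal Ω) (frontier Ω ∩ U) x :=
    ((h1 x hxU).mono inter_subset_right).congr (fun y hy => (h y hy.2 hy.1).2.1) (h x hxU hx).2.1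
  exact h3.mono_of_mem_nhdsWithin (inter_mem_nhdsWithin _ (hU.mem_nhds hxU))

theorem mem_domain_of_mem_closure (hΩ : IsBoundedC2Domain Ω) {x : Space n}
    (hx : x ∈ closure Ω) (hxS : x ∉ frontier Ω) : x ∈ Ω := by
  by_contra h
  exact hxS ⟨hx, by rwa [hΩ.isOpen.interior_eq]⟩

/-- At a boundary point the tangent cone contains an open half-space, which spans. This makes
`fderivWithin` on the closure obey the usual calculus rules up to the boundary. -/
theorem uniqueDiffOn_closure (hΩ : IsBoundedC2Domain Ω) : UniqueDiffOn ℝ (closure Ω) := by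
  intro x hx
  by_cases hxS : x ∈ frontier Ω
  swap
  · exact uniqueDiffWithinAt_of_mem_nhds
      (mem_of_superset (hΩ.isOpen.mem_nhds (mem_domain_of_mem_closure hΩ hx hxS)) subset_closure)
  have hν := isInnerNormal_innerNormal hΩ hxS
  refine ⟨?_, subset_closure hx⟩
  have h1 : {w : Space n | 0 < inner ℝ w (innerNormal Ω x)} ⊆ tangentConeAt ℝ (closure Ω) x := by
    intro w hw
    refine mem_tangentConeAt_of_add_smul_mem (l := 𝓝[>] (0 : ℝ)) (c := id)
      (tendsto_id.mono_left (nhdsGT_le_nhdsNE 0)) ?_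
    filter_upwards [hν.2.1 w hw] with t ht using subset_closure ht
  have hu1 : (inner ℝ (innerNormal Ω x) (innerNormal Ω x) : ℝ) = 1 := by
    rw [real_inner_self_eq_norm_sq, hν.1, one_pow]
  have h2 : Submodule.span ℝ (tangentConeAt ℝ (closure Ω) x) = ⊤ := by
    refine eq_top_iff.2 fun w _ => ?_
    have hm : ∀ w : Space n, 0 < inner ℝ w (innerNormal Ω x) →
        w ∈ Submodule.span ℝ (tangentConeAt ℝ (closure Ω) x) :=
      fun w hw => Submodule.subset_span (h1 hw)
    have h3 := hm (innerNormal Ω x) (by rw [hu1]; norm_num)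
    have h4 := hm (w + (|inner ℝ w (innerNormal Ω x)| + 1) • innerNormal Ω x) (by
      rw [inner_add_left, inner_smul_left, hu1]
      have := neg_abs_le (inner ℝ w (innerNormal Ω x))
      simp
      linarith)
    have h5 := Submodule.sub_mem _ h4
      (Submodule.smul_mem _ (|inner ℝ w (innerNormal Ω x)| + 1) h3)
    simpa using h5
  rw [h2]
  simp

end InnerNormal

/-! ### Quadratic tangency of the boundary to its tangent planes -/

section Tangency

variable {n : ℕ} {Ω : Set (Space n)}

/-- Mean value inequality for `f` minus its linear part at `y` along a segment, `fderiv ℝ f` being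
Lipschitz near `z`. The constant is uniform in both points, as the compactness argument below
requires. -/
theorem exists_taylor_bound {U : Set (Space n)} {f : Space n → ℝ} (hU : IsOpen U)
    (hf : ContDiffOn ℝ 2 f U) {z : Space n} (hz : z ∈ U) :
    ∃ C : ℝ, 0 ≤ C ∧ ∃ W ∈ 𝓝 z, W ⊆ U ∧ ∀ x ∈ W, ∀ y ∈ W,
      |f x - f y - fderiv ℝ f y (x - y)| ≤ C * ‖x - y‖ ^ 2 := by
  have h1 : ContDiffAt ℝ 1 (fderiv ℝ f) z :=
    (hf.fderiv_of_isOpen hU (by norm_num)).contDiffAt (hU.mem_nhds hz)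
  obtain ⟨K, t, ht, hK⟩ := h1.exists_lipschitzOnWith
  obtain ⟨ε, hε, hεb⟩ := Metric.mem_nhds_iff.1 (inter_mem ht (hU.mem_nhds hz))
  refine ⟨K, K.2, Metric.ball z ε, Metric.ball_mem_nhds z hε, fun x hx => (hεb hx).2,
    fun x hx y hy => ?_⟩
  have hseg : segment ℝ y x ⊆ Metric.ball z ε := (convex_ball z ε).segment_subset hy hx
  have h2 := (convex_segment (𝕜 := ℝ) y x).norm_image_sub_le_of_norm_hasFDerivWithin_le'
    (f := f) (f' := fderiv ℝ f) (φ := fderiv ℝ f y) (C := K * ‖x - y‖) (x := y) (y := x)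
    (fun w hw => ((hf.contDiffAt (hU.mem_nhds (hεb (hseg hw)).2)).differentiableAt
      (by norm_num)).hasFDerivAt.hasFDerivWithinAt)
    (fun w hw => ?_) (left_mem_segment ℝ y x) (right_mem_segment ℝ y x)
  · rw [← Real.norm_eq_abs]
    calc _ ≤ _ := h2
      _ = _ := by ring
  · have h3 := hK.dist_le_mul w (hεb (hseg hw)).1 y (hεb hy).1
    rw [dist_eq_norm, dist_eq_norm] at h3
    refine h3.trans (mul_le_mul_of_nonneg_left ?_ K.2)
    exact norm_sub_le_of_mem_segment hw

/-- Compactness of `S × S`. Near the diagonal, both points are zeros of the defining function and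
Taylor's bound applies; away from it `‖y - x‖` is bounded below and Cauchy-Schwarz suffices. -/
theorem exists_inner_normal_le (hΩ : IsBoundedC2Domain Ω) :
    ∃ C : ℝ, 0 ≤ C ∧ ∀ x ∈ frontier Ω, ∀ y ∈ frontier Ω,
      |inner ℝ (y - x) (innerNormal Ω y)| ≤ C * ‖y - x‖ ^ 2 := by
  have hK : IsCompact (frontier Ω) :=
    Metric.isCompact_of_isClosed_isBounded isClosed_frontier
      (hΩ.isBounded.closure.subset frontier_subset_closure)
  have hKK := hK.prod hK
  let pr : Set (Space n × Space n) → Prop := fun A => ∃ C : ℝ, 0 ≤ C ∧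
    ∀ q ∈ A, q.1 ∈ frontier Ω → q.2 ∈ frontier Ω →
      |inner ℝ (q.2 - q.1) (innerNormal Ω q.2)| ≤ C * ‖q.2 - q.1‖ ^ 2
  have hpr : pr (frontier Ω ×ˢ frontier Ω) := by
    refine hKK.induction_on (p := pr) ⟨0, le_rfl, by simp⟩ ?_ ?_ ?_
    · rintro s t hst ⟨C, hC, h⟩
      exact ⟨C, hC, fun q hq => h q (hst hq)⟩
    · rintro s t ⟨C, hC, h⟩ ⟨C', hC', h'⟩
      refine ⟨C + C', add_nonneg hC hC', fun q hq h1 h2 => ?_⟩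
      have h3 : 0 ≤ C * ‖q.2 - q.1‖ ^ 2 := by positivity
      have h4 : 0 ≤ C' * ‖q.2 - q.1‖ ^ 2 := by positivity
      rw [add_mul]
      rcases hq with hq | hq
      · linarith [h q hq h1 h2]
      · linarith [h' q hq h1 h2]
    · rintro ⟨a, b⟩ ⟨ha, hb⟩
      by_cases hab : a = b
      · subst hab
        obtain ⟨U, f, hU, hxU, hf, hg, h⟩ := boundary_chart hΩ ha
        obtain ⟨C, hC, W, hW, hWU, hT⟩ := exists_taylor_bound hU hf hxU
        have hcont : ContinuousAt (fun y => ‖gradient f y‖⁻¹) a := by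
          have := (contDiffOn_gradient hU hf).continuousOn.continuousAt (hU.mem_nhds hxU)
          exact this.norm.inv₀ (norm_ne_zero_iff.2 (hg a hxU))
        have hB : ∀ᶠ y in 𝓝 a, ‖gradient f y‖⁻¹ < ‖gradient f a‖⁻¹ + 1 :=
          hcont.eventually (gt_mem_nhds (by linarith))
        refine ⟨W ×ˢ (W ∩ {y | ‖gradient f y‖⁻¹ < ‖gradient f a‖⁻¹ + 1}),
          mem_nhdsWithin_of_mem_nhds (prod_mem_nhds hW (inter_mem hW hB)),
          (‖gradient f a‖⁻¹ + 1) * C, by positivity, ?_⟩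
        rintro ⟨x, y⟩ ⟨hx, hy, hy'⟩ hxS hyS
        simp only at hx hy hy' hxS hyS ⊢
        have h1 := hT x hx y hy
        rw [(h x (hWU hx) hxS).1, (h y (hWU hy) hyS).1] at h1
        rw [(h y (hWU hy) hyS).2.1, inner_smul_right, abs_mul, abs_of_nonneg (by positivity),
          mul_assoc]
        refine mul_le_mul (le_of_lt hy') ?_ (abs_nonneg _) (by positivity)
        have h2 : inner ℝ (y - x) (gradient f y) = - fderiv ℝ f y (x - y) := by
          rw [real_inner_comm, ← map_neg, neg_sub]
          simp [gradient]
        rw [h2, norm_sub_rev y x]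
        simpa using h1
      · have hd : 0 < dist b a := dist_pos.2 (Ne.symm hab)
        have hev : ∀ᶠ q : Space n × Space n in 𝓝 (a, b), dist b a / 2 < dist q.2 q.1 := by
          have : ContinuousAt (fun q : Space n × Space n => dist q.2 q.1) (a, b) := by fun_prop
          exact this.eventually (lt_mem_nhds (by simpa using hd))
        refine ⟨_, mem_nhdsWithin_of_mem_nhds hev, (dist b a / 2)⁻¹, by positivity, ?_⟩
        rintro ⟨x, y⟩ hq hxS hyS
        simp only [mem_ofPred_eq, dist_eq_norm y x] at hq ⊢
        have h1 := abs_real_inner_le_norm (y - x) (innerNormal Ω y)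
        rw [norm_innerNormal hΩ hyS, mul_one] at h1
        refine h1.trans ?_
        rw [inv_mul_eq_div, le_div_iff₀ (by positivity)]
        nlinarith [norm_nonneg (y - x)]
  obtain ⟨C, hC, h⟩ := hpr
  exact ⟨C, hC, fun x hx y hy => h (x, y) ⟨hx, hy⟩ hx hy⟩

end Tangency

/-! ### The one-sided tube and its projection onto the boundary -/

section Tube

variable {n : ℕ} {Ω : Set (Space n)}

theorem isOpen_infDist_lt (s : Set (Space n)) (a : ℝ) :
    IsOpen {y | Metric.infDist y s < a} :=
  isOpen_lt (Metric.continuous_infDist_pt s) continuous_const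

theorem ball_subset_of_disjoint_frontier (hΩ : IsBoundedC2Domain Ω) {x : Space n} {s : ℝ}
    (hx : x ∈ Ω) (hs : 0 < s) (h : ∀ y ∈ Metric.ball x s, y ∉ frontier Ω) :
    Metric.ball x s ⊆ Ω := by
  refine (convex_ball x s).isPreconnected.subset_left_of_subset_union hΩ.isOpen
    (isClosed_closure (s := Ω)).isOpen_compl ?_ ?_ ⟨x, Metric.mem_ball_self hs, hx⟩
  · exact disjoint_left.2 fun y hy hy' => hy' (subset_closure hy)
  · intro y hy
    by_cases hyc : y ∈ closure Ω
    · exact Or.inl (mem_domain_of_mem_closure hΩ hyc (h y hy))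
    · exact Or.inr hyc

/-- If `y` is nearest to `x`, the open ball about `x` of radius `dist x y` lies in `Ω`. Were `x - y`
not along the normal at `y`, some direction would enter this ball and yet leave the closure of `Ω`.
-/
theorem eq_normalExp_nearest (hΩ : IsBoundedC2Domain Ω) {x : Space n} (hx : x ∈ closure Ω)
    (hne : (frontier Ω).Nonempty) :
    ∃ y ∈ frontier Ω, x = normalExp Ω (y, Metric.infDist x (frontier Ω)) := by
  obtain ⟨y, hy, hd⟩ := isClosed_frontier.exists_infDist_eq_dist hne x
  refine ⟨y, hy, ?_⟩
  rw [hd]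
  rcases eq_or_ne x y with rfl | hxy
  · simp [normalExp]
  have hs : 0 < dist x y := dist_pos.2 hxy
  have hxS : x ∉ frontier Ω := fun h => by
    rw [Metric.infDist_zero_of_mem h] at hd
    exact hs.ne hd
  have hB := ball_subset_of_disjoint_frontier hΩ (mem_domain_of_mem_closure hΩ hx hxS) hs
    (fun z hz hzS => by
      have := Metric.infDist_le_dist_of_mem (x := x) hzS
      rw [hd, dist_comm x z] at this
      exact absurd hz (by simpa using this))
  have hν := isInnerNormal_innerNormal hΩ hy
  have hs' : ‖x - y‖ ≠ 0 := by rw [← dist_eq_norm]; exact hs.ne'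
  have key : ‖x - y‖⁻¹ • (x - y) = innerNormal Ω y := by
    refine eq_of_forall_inner_nonneg (by simp [norm_smul, sub_ne_zero.2 hxy]) hν.1 fun w hw => ?_
    by_contra hlt
    have hw' : 0 < inner ℝ w (x - y) := by
      rw [inner_smul_right] at hw
      exact pos_of_mul_pos_right hw (by positivity)
    have hev : ∀ᶠ t : ℝ in 𝓝[>] 0, y + t • w ∈ Metric.ball x (dist x y) := by
      have h1 : ∀ᶠ t : ℝ in 𝓝[>] 0, t * ‖w‖ ^ 2 < 2 * inner ℝ w (x - y) := by
        have hc : ContinuousAt (fun t : ℝ => t * ‖w‖ ^ 2) 0 := by fun_prop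
        exact (hc.eventually (gt_mem_nhds (by simpa using hw'))).filter_mono nhdsWithin_le_nhds
      filter_upwards [h1, self_mem_nhdsWithin] with t ht (ht0 : 0 < t)
      rw [Metric.mem_ball, dist_eq_norm, dist_eq_norm]
      refine lt_of_pow_lt_pow_left₀ 2 (norm_nonneg _) ?_
      have : y + t • w - x = t • w - (x - y) := by abel
      rw [this, norm_sub_sq_real, norm_smul, inner_smul_left, mul_pow, Real.norm_eq_abs, sq_abs]
      simp only [conj_trivial]
      nlinarith
    obtain ⟨t, h1, h2⟩ := (hev.and (hν.2.2 w (not_le.1 hlt))).exists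
    exact h2 (subset_closure (hB h1))
  rw [normalExp, ← key, dist_eq_norm, smul_smul, mul_inv_cancel₀ hs', one_smul]
  abel

/-- `ξ` is a `C¹` projection of the one-sided tube of width `a` onto the boundary which realizes
the distance and along which the normal has differential bounded by `C`. -/
structure IsTubeProjection (Ω : Set (Space n)) (a C : ℝ) (ξ : Space n → Space n) : Prop where
  contDiffOn : ContDiffOn ℝ 1 ξ (oneSidedTube Ω a)
  mem : ∀ x ∈ oneSidedTube Ω a, ξ x ∈ frontier Ω
  fix : ∀ x ∈ frontier Ω, ξ x = x
  norm_sub : ∀ x ∈ oneSidedTube Ω a, ‖ξ x - x‖ = Metric.infDist x (frontier Ω)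
  norm_fderivWithin : ∀ x ∈ oneSidedTube Ω a,
    ‖fderivWithin ℝ (fun y => innerNormal Ω (ξ y)) (closure Ω) x‖ ≤ C
  inner_fderivWithin : ∀ x ∈ oneSidedTube Ω a, ∀ v,
    inner ℝ (fderivWithin ℝ ξ (closure Ω) x v) (innerNormal Ω (ξ x)) = 0

theorem uniqueDiffOn_oneSidedTube (hΩ : IsBoundedC2Domain Ω) (a : ℝ) :
    UniqueDiffOn ℝ (oneSidedTube Ω a) :=
  (uniqueDiffOn_closure hΩ).inter (isOpen_infDist_lt _ a)

theorem fderivWithin_oneSidedTube {F : Type*} [NormedAddCommGroup F] [NormedSpace ℝ F]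
    {a : ℝ} {x : Space n} (hx : x ∈ oneSidedTube Ω a) (f : Space n → F) :
    fderivWithin ℝ f (oneSidedTube Ω a) x = fderivWithin ℝ f (closure Ω) x :=
  fderivWithin_inter ((isOpen_infDist_lt _ a).mem_nhds hx.2)

theorem hasFDerivWithinAt_closure {F : Type*} [NormedAddCommGroup F] [NormedSpace ℝ F]
    {a : ℝ} {x : Space n} (hx : x ∈ oneSidedTube Ω a) {f : Space n → F}
    (hf : ContDiffOn ℝ 1 f (oneSidedTube Ω a)) :
    HasFDerivWithinAt f (fderivWithin ℝ f (closure Ω) x) (closure Ω) x := by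
  have h1 : DifferentiableWithinAt ℝ f (oneSidedTube Ω a) x :=
    (hf.differentiableOn (by norm_num)) x hx
  have h2 := h1.hasFDerivWithinAt
  rw [fderivWithin_oneSidedTube hx] at h2
  exact (hasFDerivWithinAt_inter ((isOpen_infDist_lt _ a).mem_nhds hx.2)).1 h2

/-- Differentiate `f ∘ ξ = 0` for a local defining function `f`: a map into `S` has derivative
tangent to `S`. -/
theorem inner_fderivWithin_eq_zero (hΩ : IsBoundedC2Domain Ω) {a : ℝ} {ξ : Space n → Space n}
    (hξ : ContDiffOn ℝ 1 ξ (oneSidedTube Ω a))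
    (hm : ∀ x ∈ oneSidedTube Ω a, ξ x ∈ frontier Ω) {x : Space n}
    (hx : x ∈ oneSidedTube Ω a) (v : Space n) :
    inner ℝ (fderivWithin ℝ ξ (closure Ω) x v) (innerNormal Ω (ξ x)) = 0 := by
  obtain ⟨U, f, hU, hxU, hf, hg, h⟩ := boundary_chart hΩ (hm x hx)
  have h1 : HasFDerivWithinAt ξ (fderivWithin ℝ ξ (closure Ω) x) (oneSidedTube Ω a) x :=
    (hasFDerivWithinAt_closure hx hξ).mono inter_subset_left
  have hd : HasFDerivAt f (fderiv ℝ f (ξ x)) (ξ x) :=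
    ((hf.contDiffAt (hU.mem_nhds hxU)).differentiableAt (by norm_num)).hasFDerivAt
  have h2 := hd.comp_hasFDerivWithinAt x h1
  have h3 : f ∘ ξ =ᶠ[𝓝[oneSidedTube Ω a] x] fun _ => (0 : ℝ) := by
    filter_upwards [h1.continuousWithinAt.eventually (hU.mem_nhds hxU), self_mem_nhdsWithin]
      with y hy hyT
    exact (h _ hy (hm y hyT)).1
  have h4 : HasFDerivWithinAt (f ∘ ξ) (0 : Space n →L[ℝ] ℝ) (oneSidedTube Ω a) x :=
    (hasFDerivWithinAt_const (0 : ℝ) x _).congr_of_eventuallyEq h3 (h _ hxU (hm x hx)).1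
  have h5 := (uniqueDiffOn_oneSidedTube hΩ a x hx).eq h2 h4
  have h6 := congrArg (fun L => L v) h5
  rw [(h _ hxU (hm x hx)).2.1, inner_smul_right, real_inner_comm]
  have h7 : inner ℝ (gradient f (ξ x)) (fderivWithin ℝ ξ (closure Ω) x v) = 0 := by
    simpa [gradient] using h6
  rw [h7, mul_zero]

theorem isCompact_closure_domain (hΩ : IsBoundedC2Domain Ω) : IsCompact (closure Ω) :=
  hΩ.isBounded.isCompact_closure

/-- The base point of the inverse normal exponential map is a nearest boundary point, by
`eq_normalExp_nearest`. The strict inequality `a < r` places the compact closed tube of width `a`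
inside the region of regularity, which yields the bound `C`. -/
theorem IsTubeRadius.exists_projection (hΩ : IsBoundedC2Domain Ω) {r a : ℝ}
    (hr : IsTubeRadius Ω r) (ha : a < r) (hne : (frontier Ω).Nonempty) :
    ∃ (C : ℝ) (ξ : Space n → Space n), 0 ≤ C ∧ IsTubeProjection Ω a C ξ := by
  obtain ⟨ψ, hψ, hinv⟩ := hr.contDiffOn_inv
  have hsub : oneSidedTube Ω a ⊆ oneSidedTube Ω r := fun x hx => ⟨hx.1, hx.2.trans ha⟩
  have hξ : ContDiffOn ℝ 1 (fun x => (ψ x).1) (oneSidedTube Ω r) := hψ.fst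
  have hnear : ∀ x ∈ oneSidedTube Ω r, (ψ x).1 ∈ frontier Ω ∧
      ‖(ψ x).1 - x‖ = Metric.infDist x (frontier Ω) := by
    intro x hx
    obtain ⟨y, hy, hxy⟩ := eq_normalExp_nearest hΩ hx.1 hne
    have h1 : ψ x = (y, Metric.infDist x (frontier Ω)) := by
      conv_lhs => rw [hxy]
      exact hinv _ ⟨hy, Metric.infDist_nonneg, hx.2⟩
    have h2 : y - x = -(Metric.infDist x (frontier Ω) • innerNormal Ω y) := by
      conv_lhs => rw [hxy]
      simp [normalExp]
    rw [h1]
    refine ⟨hy, ?_⟩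
    rw [h2, norm_neg, norm_smul, norm_innerNormal hΩ hy, mul_one,
      Real.norm_of_nonneg Metric.infDist_nonneg]
  have hN : ContDiffOn ℝ 1 (fun x => innerNormal Ω (ψ x).1) (oneSidedTube Ω r) :=
    (contDiffOn_innerNormal hΩ).comp hξ fun x hx => (hnear x hx).1
  have hcont : ContinuousOn (fun x => fderivWithin ℝ (fun x => innerNormal Ω (ψ x).1)
      (closure Ω) x) (oneSidedTube Ω r) :=
    (hN.continuousOn_fderivWithin (uniqueDiffOn_oneSidedTube hΩ r) (by norm_num)).congr
      fun x hx => (fderivWithin_oneSidedTube hx _).symm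
  have hK : IsCompact (closure Ω ∩ {y | Metric.infDist y (frontier Ω) ≤ a}) :=
    (isCompact_closure_domain hΩ).inter_right
      (isClosed_le (Metric.continuous_infDist_pt _) continuous_const)
  obtain ⟨C, hC⟩ := hK.exists_bound_of_continuousOn
    (hcont.mono fun x hx => ⟨hx.1, lt_of_le_of_lt hx.2 ha⟩)
  refine ⟨max C 0, fun x => (ψ x).1, le_max_right _ _, hξ.mono hsub,
    fun x hx => (hnear x (hsub hx)).1, fun x hx => ?_, fun x hx => (hnear x (hsub hx)).2,
    fun x hx => (hC x ⟨hx.1, le_of_lt hx.2⟩).trans (le_max_left _ _), fun x hx v => ?_⟩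
  · have h0 : Metric.infDist x (frontier Ω) = 0 := Metric.infDist_zero_of_mem hx
    have h1 := (hnear x ⟨frontier_subset_closure hx, by rw [h0]; exact hr.pos⟩).2
    rw [h0, norm_eq_zero, sub_eq_zero] at h1
    exact h1
  · exact inner_fderivWithin_eq_zero hΩ (hξ.mono hsub) (fun x hx => (hnear x (hsub hx)).1) hx v

theorem IsTubeRadius.le_diam (hΩ : IsBoundedC2Domain Ω) {r : ℝ} (hr : IsTubeRadius Ω r)
    {x : Space n} (hx : x ∈ frontier Ω) : r ≤ Metric.diam (closure Ω) := by
  refine le_of_forall_lt_imp_le_of_dense fun t ht => ?_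
  rcases lt_or_ge t 0 with h | h
  · exact h.le.trans Metric.diam_nonneg
  have h1 := (hr.bijOn.mapsTo (x := (x, t)) ⟨hx, h, ht⟩).1
  have h2 := Metric.dist_le_diam_of_mem hΩ.isBounded.closure h1 (frontier_subset_closure hx)
  rw [dist_eq_norm] at h2
  simpa [normalExp, norm_smul, norm_innerNormal hΩ hx, abs_of_nonneg h] using h2

/-- A projection onto the boundary, with uniform bounds, that serves all admissible tube radii. -/
theorem exists_uniform_projection (hΩ : IsBoundedC2Domain Ω) (hne : (frontier Ω).Nonempty)
    (hex : ∃ r, IsTubeRadius Ω r) :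
    ∃ (C a : ℝ) (ξ : Space n → Space n), 0 ≤ C ∧ IsTubeProjection Ω a C ξ ∧
      (∀ r, IsTubeRadius Ω r → r / 2 ≤ a) ∧
      ∀ x ∈ frontier Ω, ∀ y ∈ frontier Ω,
        |inner ℝ (y - x) (innerNormal Ω y)| ≤ C * ‖y - x‖ ^ 2 := by
  obtain ⟨x, hx⟩ := hne
  have hbdd : BddAbove {r | IsTubeRadius Ω r} :=
    ⟨Metric.diam (closure Ω), fun r hr => IsTubeRadius.le_diam hΩ hr hx⟩
  obtain ⟨r₀, hr₀⟩ := hex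
  have hpos : 0 < sSup {r | IsTubeRadius Ω r} := hr₀.pos.trans_le (le_csSup hbdd hr₀)
  -- Half the supremum of all tube radii dominates every `ρS / 2` and is still below some tube
  -- radius. The resulting constants, and so `Λ`, depend on `S` but not on the chosen `ρS`.
  obtain ⟨r, hr, hlt⟩ := exists_lt_of_lt_csSup ⟨r₀, hr₀⟩
    (show sSup {r | IsTubeRadius Ω r} / 2 < sSup {r | IsTubeRadius Ω r} by linarith)
  obtain ⟨C, ξ, hC, hξ⟩ := hr.exists_projection hΩ hlt ⟨x, hx⟩
  obtain ⟨C', hC', h⟩ := exists_inner_normal_le hΩ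
  refine ⟨C + C', _, ξ, add_nonneg hC hC', ⟨hξ.contDiffOn, hξ.mem, hξ.fix, hξ.norm_sub,
    fun x hx => (hξ.norm_fderivWithin x hx).trans (by linarith), hξ.inner_fderivWithin⟩,
    fun s hs => ?_, fun x hx y hy => (h x hx y hy).trans ?_⟩
  · linarith [le_csSup hbdd hs]
  · exact mul_le_mul_of_nonneg_right (by linarith) (by positivity)

end Tube

/-! ### Divergence along a plane -/

section PlaneDivergence

variable {m n : ℕ}

theorem norm_plane_le (P : Grass m n) : ‖P.1‖ ≤ 1 :=
  P.2.1.norm_le _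

theorem norm_plane_apply_le (P : Grass m n) (v : Space n) : ‖P.1 v‖ ≤ ‖v‖ :=
  (P.1.le_opNorm v).trans (mul_le_of_le_one_left (norm_nonneg _) (norm_plane_le P))

theorem planeDiv_id (P : Grass m n) : planeDiv P (ContinuousLinearMap.id ℝ (Space n)) = m := by
  have hidem : ∀ v, P.1 (P.1 v) = P.1 v := fun v =>
    congrArg (fun L : Space n →L[ℝ] Space n => L v) P.2.1.isIdempotentElem
  have h : LinearMap.IsProj P.1.range (P.1 : Space n →ₗ[ℝ] Space n) :=
    ⟨fun v => ⟨v, rfl⟩, by rintro _ ⟨v, rfl⟩; exact hidem v⟩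
  rw [planeDiv, ContinuousLinearMap.comp_id, h.trace, P.2.2]

theorem planeDiv_add (P : Grass m n) (A B : Space n →L[ℝ] Space n) :
    planeDiv P (A + B) = planeDiv P A + planeDiv P B := by
  simp [planeDiv, ContinuousLinearMap.comp_add]

theorem planeDiv_smul (P : Grass m n) (c : ℝ) (A : Space n →L[ℝ] Space n) :
    planeDiv P (c • A) = c * planeDiv P A := by
  simp [planeDiv]

theorem planeDiv_smulRight (P : Grass m n) (g : Space n →L[ℝ] ℝ) (v : Space n) :
    planeDiv P (g.smulRight v) = g (P.1 v) := by
  have : ((P.1 ∘L g.smulRight v : Space n →L[ℝ] Space n) : Space n →ₗ[ℝ] Space n)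
      = LinearMap.smulRight (g : Space n →ₗ[ℝ] ℝ) (P.1 v) := by
    ext w; simp
  rw [planeDiv, this, LinearMap.trace_smulRight]
  rfl

theorem abs_planeDiv_le (P : Grass m n) (A : Space n →L[ℝ] Space n) :
    |planeDiv P A| ≤ (n + 1) * ‖A‖ := by
  rw [planeDiv, LinearMap.trace_eq_sum_inner _ (EuclideanSpace.basisFun (Fin (n + 1)) ℝ)]
  refine (Finset.abs_sum_le_sum_abs _ _).trans ?_
  have h : ∀ i : Fin (n + 1), |inner ℝ (EuclideanSpace.basisFun (Fin (n + 1)) ℝ i)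
      (P.1 (A (EuclideanSpace.basisFun (Fin (n + 1)) ℝ i)))| ≤ ‖A‖ := by
    intro i
    refine (abs_real_inner_le_norm _ _).trans ?_
    rw [OrthonormalBasis.norm_eq_one, one_mul]
    refine (norm_plane_apply_le P _).trans ((A.le_opNorm _).trans ?_)
    rw [OrthonormalBasis.norm_eq_one, mul_one]
  refine (Finset.sum_le_sum fun i _ => h i).trans ?_
  simp

theorem continuous_planeDiv :
    Continuous fun q : Grass m n × (Space n →L[ℝ] Space n) => planeDiv q.1 q.2 := by
  have h : ∀ q : Grass m n × (Space n →L[ℝ] Space n), planeDiv q.1 q.2 =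
      ∑ i, inner ℝ (EuclideanSpace.basisFun (Fin (n + 1)) ℝ i)
        (q.1.1 (q.2 (EuclideanSpace.basisFun (Fin (n + 1)) ℝ i))) := fun q => by
    rw [planeDiv, LinearMap.trace_eq_sum_inner _ (EuclideanSpace.basisFun (Fin (n + 1)) ℝ)]
    rfl
  simp_rw [h]
  refine continuous_finsetSum _ fun i _ => Continuous.inner continuous_const ?_
  have h1 : Continuous fun q : Grass m n × (Space n →L[ℝ] Space n) => q.1.1 :=
    continuous_subtype_val.comp continuous_fst
  exact h1.clm_apply (continuous_snd.clm_apply continuous_const)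

end PlaneDivergence

/-! ### The one-variable cut-off -/

section Cutoff

/-- A smooth non-increasing function equal to `1` on `(-∞, 1]` and to `0` on `[1 + δ, ∞)`. -/
noncomputable def cutoff (δ s : ℝ) : ℝ := Real.smoothTransition ((1 + δ - s) / δ)

variable {δ s : ℝ}

theorem contDiff_cutoff (δ : ℝ) : ContDiff ℝ 2 (cutoff δ) := by
  have : ContDiff ℝ 2 fun s : ℝ => (1 + δ - s) / δ := by fun_prop
  exact (Real.smoothTransition.contDiff (n := 2)).comp this

theorem cutoff_nonneg (δ s : ℝ) : 0 ≤ cutoff δ s := Real.smoothTransition.nonneg _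

theorem cutoff_le_one (δ s : ℝ) : cutoff δ s ≤ 1 := Real.smoothTransition.le_one _

theorem cutoff_eq_one (hδ : 0 < δ) (hs : s ≤ 1) : cutoff δ s = 1 :=
  Real.smoothTransition.one_of_one_le (by rw [le_div_iff₀ hδ]; linarith)

theorem cutoff_eq_zero (hδ : 0 < δ) (hs : 1 + δ ≤ s) : cutoff δ s = 0 :=
  Real.smoothTransition.zero_of_nonpos (div_nonpos_of_nonpos_of_nonneg (by linarith) hδ.le)

theorem antitone_cutoff (hδ : 0 < δ) : Antitone (cutoff δ) := fun s t hst =>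
  Real.smoothTransition.monotone (by gcongr)

theorem deriv_cutoff_nonpos (hδ : 0 < δ) (s : ℝ) : deriv (cutoff δ) s ≤ 0 :=
  (antitone_cutoff hδ).deriv_nonpos

theorem hasDerivAt_cutoff (δ s : ℝ) : HasDerivAt (cutoff δ) (deriv (cutoff δ) s) s :=
  (((contDiff_cutoff δ).differentiable (by norm_num)) s).hasDerivAt

theorem continuous_deriv_cutoff (δ : ℝ) : Continuous (deriv (cutoff δ)) :=
  (contDiff_cutoff δ).continuous_deriv (by norm_num)

theorem deriv_cutoff_of_lt (hδ : 0 < δ) (hs : s < 1) : deriv (cutoff δ) s = 0 := by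
  have h : cutoff δ =ᶠ[𝓝 s] fun _ => (1 : ℝ) := by
    filter_upwards [gt_mem_nhds hs] with t ht using cutoff_eq_one hδ (le_of_lt ht)
  rw [h.deriv_eq, deriv_const]

theorem deriv_cutoff_of_gt (hδ : 0 < δ) (hs : 1 + δ < s) : deriv (cutoff δ) s = 0 := by
  have h : cutoff δ =ᶠ[𝓝 s] fun _ => (0 : ℝ) := by
    filter_upwards [lt_mem_nhds hs] with t ht using cutoff_eq_zero hδ (le_of_lt ht)
  rw [h.deriv_eq, deriv_const]

theorem exists_abs_deriv_cutoff_mul_le (hδ : 0 < δ) :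
    ∃ M : ℝ, ∀ s : ℝ, 0 ≤ s → |deriv (cutoff δ) s * s| ≤ M := by
  have hc : Continuous fun s => deriv (cutoff δ) s * s :=
    (continuous_deriv_cutoff δ).mul continuous_id
  obtain ⟨M, hM⟩ := (isCompact_Icc (a := (0 : ℝ)) (b := 1 + δ)).exists_bound_of_continuousOn
    hc.continuousOn
  refine ⟨max M 0, fun s hs => ?_⟩
  rcases le_or_gt s (1 + δ) with h | h
  · exact (hM s ⟨hs, h⟩).trans (le_max_left _ _)
  · simp [deriv_cutoff_of_gt hδ h]

end Cutoff

/-! ### The test field and its divergence -/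

section TestField

variable {m n : ℕ} {Ω : Set (Space n)}

/-- The radial cut-off `x ↦ η(|x - x₀|² / ρ²)`. -/
noncomputable def radialCutoff (x₀ : Space n) (δ ρ : ℝ) (x : Space n) : ℝ :=
  cutoff δ (‖x - x₀‖ ^ 2 / ρ ^ 2)

/-- The smoothed mass `∫ η(|x - x₀|² / ρ²) dμ`. -/
noncomputable def smoothMass (μ : Measure (Space n)) (x₀ : Space n) (δ ρ : ℝ) : ℝ :=
  ∫ x, radialCutoff x₀ δ ρ x ∂μ

/-- The logarithmic radial derivative `ρ d/dρ` of the cut-off `η(|x - x₀|² / ρ²)`. -/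
noncomputable def cutoffSlope (x₀ : Space n) (δ ρ : ℝ) (x : Space n) : ℝ :=
  -2 * (deriv (cutoff δ) (‖x - x₀‖ ^ 2 / ρ ^ 2) * (‖x - x₀‖ ^ 2 / ρ ^ 2))

theorem contDiff_radialCutoff (x₀ : Space n) (δ ρ : ℝ) :
    ContDiff ℝ 1 (radialCutoff x₀ δ ρ) := by
  have h : ContDiff ℝ 1 fun x : Space n => ‖x - x₀‖ ^ 2 / ρ ^ 2 :=
    ((contDiff_id.sub contDiff_const).norm_sq ℝ).div_const _
  exact ((contDiff_cutoff δ).of_le (by norm_num)).comp h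

theorem hasFDerivAt_radialCutoff (x₀ : Space n) (δ ρ : ℝ) (x : Space n) :
    HasFDerivAt (radialCutoff x₀ δ ρ)
      ((deriv (cutoff δ) (‖x - x₀‖ ^ 2 / ρ ^ 2) * (2 / ρ ^ 2)) • innerSL ℝ (x - x₀)) x := by
  have h1 : HasFDerivAt (fun x : Space n => x - x₀) (ContinuousLinearMap.id ℝ (Space n)) x :=
    (hasFDerivAt_id x).sub_const x₀
  have h2 := (h1.norm_sq).mul_const (ρ ^ 2)⁻¹
  have h3 := (hasDerivAt_cutoff δ (‖x - x₀‖ ^ 2 * (ρ ^ 2)⁻¹)).comp_hasFDerivAt x h2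
  simp only [← div_eq_mul_inv] at h3
  refine h3.congr_fderiv ?_
  ext v
  simp
  ring

theorem radialCutoff_nonneg (x₀ : Space n) (δ ρ : ℝ) (x : Space n) :
    0 ≤ radialCutoff x₀ δ ρ x :=
  cutoff_nonneg _ _

theorem norm_radialCutoff_le_one (x₀ : Space n) (δ ρ : ℝ) (x : Space n) :
    ‖radialCutoff x₀ δ ρ x‖ ≤ 1 := by
  rw [Real.norm_of_nonneg (radialCutoff_nonneg _ _ _ _)]
  exact cutoff_le_one _ _

theorem radialCutoff_eq_zero {x₀ x : Space n} {δ ρ : ℝ} (hδ : 0 < δ) (hρ : 0 < ρ)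
    (h : (1 + δ) * ρ ^ 2 ≤ ‖x - x₀‖ ^ 2) : radialCutoff x₀ δ ρ x = 0 :=
  cutoff_eq_zero hδ (by rw [le_div_iff₀ (by positivity)]; exact h)

theorem mem_oneSidedTube_of_norm_lt {x₀ x : Space n} {a : ℝ} (hx₀ : x₀ ∈ frontier Ω)
    (hx : x ∈ closure Ω) (h : ‖x - x₀‖ < a) : x ∈ oneSidedTube Ω a := by
  refine ⟨hx, lt_of_le_of_lt (Metric.infDist_le_dist_of_mem hx₀) ?_⟩
  rwa [dist_eq_norm]

/-- The vector field `η(|x - x₀|² / ρ²) (x - x₀ + Z(x))`. -/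
noncomputable def testField (x₀ : Space n) (δ ρ : ℝ) (Z : Space n → Space n) (x : Space n) :
    Space n :=
  radialCutoff x₀ δ ρ x • (x - x₀ + Z x)

variable {x₀ : Space n} {a δ ρ B : ℝ} {Z : Space n → Space n}

theorem eventually_testField_eq_zero (hδ : 0 < δ) (hρ : 0 < ρ) {x : Space n}
    (h : (1 + δ) * ρ ^ 2 < ‖x - x₀‖ ^ 2) : testField x₀ δ ρ Z =ᶠ[𝓝 x] fun _ => 0 := by
  have hc : ContinuousAt (fun y : Space n => ‖y - x₀‖ ^ 2) x := by fun_prop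
  filter_upwards [hc.eventually (lt_mem_nhds h)] with y hy
  rw [testField, radialCutoff_eq_zero hδ hρ (le_of_lt hy), zero_smul]

theorem contDiffOn_testField (hx₀ : x₀ ∈ frontier Ω) (ha : 0 < a) (hδ : 0 < δ) (hρ : 0 < ρ)
    (hρa : (1 + δ) * ρ ^ 2 < a ^ 2) (hZ : ContDiffOn ℝ 1 Z (oneSidedTube Ω a)) :
    ContDiffOn ℝ 1 (testField x₀ δ ρ Z) (closure Ω) := by
  intro x hx
  rcases lt_or_ge (‖x - x₀‖ ^ 2) (a ^ 2) with h | h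
  · have hxT := mem_oneSidedTube_of_norm_lt hx₀ hx (lt_of_pow_lt_pow_left₀ 2 ha.le h)
    have h1 : ContDiffOn ℝ 1 (testField x₀ δ ρ Z) (oneSidedTube Ω a) :=
      (contDiff_radialCutoff x₀ δ ρ).contDiffOn.smul
        ((contDiff_id.sub contDiff_const).contDiffOn.add hZ)
    exact (h1 x hxT).mono_of_mem_nhdsWithin
      (inter_mem self_mem_nhdsWithin
        (mem_nhdsWithin_of_mem_nhds ((isOpen_infDist_lt _ a).mem_nhds hxT.2)))
  · exact (contDiffAt_const.congr_of_eventuallyEq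
      (eventually_testField_eq_zero hδ hρ (hρa.trans_le h))).contDiffWithinAt

/-- By the product rule the divergence is `η (m + div_P Z)` plus `2η'/ρ²` times `⟨x - x₀, P(x - x₀ +
Z)⟩`. As `η' ≤ 0`, an upper bound of this product suffices, and `|P v| ≤ |v|` gives one independent
of `P`. -/
theorem planeDiv_testField_ge (hΩ : IsBoundedC2Domain Ω) (hx₀ : x₀ ∈ frontier Ω) (ha : 0 < a)
    (hδ : 0 < δ) (hδ1 : δ ≤ 1) (hρ : 0 < ρ) (hB : 0 ≤ B)
    (hρa : (1 + δ) * ρ ^ 2 < a ^ 2) (hZ : ContDiffOn ℝ 1 Z (oneSidedTube Ω a))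
    (hZn : ∀ x ∈ oneSidedTube Ω a, ‖x - x₀‖ ^ 2 ≤ 2 * ρ ^ 2 → ‖Z x‖ ≤ B * ρ ^ 2)
    (hZd : ∀ x ∈ oneSidedTube Ω a, ‖x - x₀‖ ^ 2 ≤ 2 * ρ ^ 2 →
      ‖fderivWithin ℝ Z (closure Ω) x‖ ≤ B * ρ) {x : Space n} (hx : x ∈ closure Ω)
    (P : Grass m n) :
    radialCutoff x₀ δ ρ x * (m - (n + 1) * (B * ρ)) - cutoffSlope x₀ δ ρ x * (1 + B * ρ)
      ≤ planeDiv P (fderivWithin ℝ (testField x₀ δ ρ Z) (closure Ω) x) := by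
  have hρ2 : 0 < ρ ^ 2 := by positivity
  rcases lt_or_ge ((1 + δ) * ρ ^ 2) (‖x - x₀‖ ^ 2) with h | h
  · have h1 := (eventually_testField_eq_zero (Z := Z) hδ hρ h).filter_mono
      (nhdsWithin_le_nhds (s := closure Ω))
    rw [h1.fderivWithin_eq (eventually_testField_eq_zero (Z := Z) hδ hρ h).self_of_nhds,
      radialCutoff_eq_zero hδ hρ h.le, cutoffSlope,
      deriv_cutoff_of_gt hδ (by rwa [lt_div_iff₀ hρ2])]
    simp [planeDiv]
  have hxT : x ∈ oneSidedTube Ω a :=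
    mem_oneSidedTube_of_norm_lt hx₀ hx (lt_of_pow_lt_pow_left₀ 2 ha.le (h.trans_lt hρa))
  have hr2 : ‖x - x₀‖ ^ 2 ≤ 2 * ρ ^ 2 := h.trans (by nlinarith)
  have hd : HasFDerivWithinAt (fun x => x - x₀ + Z x)
      (ContinuousLinearMap.id ℝ (Space n) + fderivWithin ℝ Z (closure Ω) x) (closure Ω) x :=
    ((hasFDerivWithinAt_id x _).sub_const x₀).add (hasFDerivWithinAt_closure hxT hZ)
  have hφ := (hasFDerivAt_radialCutoff x₀ δ ρ x).hasFDerivWithinAt (s := closure Ω) |>.smul hd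
  have hφ' : fderivWithin ℝ (testField x₀ δ ρ Z) (closure Ω) x = _ :=
    hφ.fderivWithin (uniqueDiffOn_closure hΩ x hx)
  rw [hφ', planeDiv_add, planeDiv_smul, planeDiv_add, planeDiv_id, planeDiv_smulRight]
  have hdiv := (abs_le.1 ((abs_planeDiv_le P (fderivWithin ℝ Z (closure Ω) x)).trans
    (mul_le_mul_of_nonneg_left (hZd x hxT hr2) (by positivity)))).1
  have hχ := cutoff_nonneg δ (‖x - x₀‖ ^ 2 / ρ ^ 2)
  have hη := deriv_cutoff_nonpos hδ (‖x - x₀‖ ^ 2 / ρ ^ 2)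
  have hcore : 2 * (deriv (cutoff δ) (‖x - x₀‖ ^ 2 / ρ ^ 2) * (‖x - x₀‖ ^ 2 / ρ ^ 2)) *
      (1 + B * ρ) ≤ deriv (cutoff δ) (‖x - x₀‖ ^ 2 / ρ ^ 2) * (2 / ρ ^ 2) *
        inner ℝ (x - x₀) (P.1 (x - x₀ + Z x)) := by
    -- Where `η'` can be non-zero, `ρ ≤ ‖x - x₀‖`, so `‖Z x‖ ≤ Bρ²` becomes the relative bound `Bρ‖x
    -- - x₀‖`.
    rcases lt_or_ge (‖x - x₀‖ ^ 2 / ρ ^ 2) 1 with hs | hs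
    · rw [deriv_cutoff_of_lt hδ hs]; simp
    have hr : ρ ≤ ‖x - x₀‖ := by
      rw [le_div_iff₀ hρ2, one_mul] at hs
      exact le_of_sq_le_sq hs (norm_nonneg _)
    have h1 : inner ℝ (x - x₀) (P.1 (x - x₀)) ≤ ‖x - x₀‖ ^ 2 := by
      refine (real_inner_le_norm _ _).trans ?_
      rw [sq]
      exact mul_le_mul_of_nonneg_left (norm_plane_apply_le P _) (norm_nonneg _)
    have h2 : inner ℝ (x - x₀) (P.1 (Z x)) ≤ ‖x - x₀‖ ^ 2 * (B * ρ) := by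
      refine (real_inner_le_norm _ _).trans ?_
      rw [sq, mul_assoc]
      refine mul_le_mul_of_nonneg_left ((norm_plane_apply_le P _).trans
        ((hZn x hxT hr2).trans ?_)) (norm_nonneg _)
      have := mul_le_mul_of_nonneg_right hr (mul_nonneg hB hρ.le)
      nlinarith
    have h3 : inner ℝ (x - x₀) (P.1 (x - x₀ + Z x)) ≤ ‖x - x₀‖ ^ 2 * (1 + B * ρ) := by
      rw [map_add, inner_add_right]; linarith
    have h4 : deriv (cutoff δ) (‖x - x₀‖ ^ 2 / ρ ^ 2) * (2 / ρ ^ 2) ≤ 0 :=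
      mul_nonpos_of_nonpos_of_nonneg hη (by positivity)
    refine le_trans (le_of_eq ?_) (mul_le_mul_of_nonpos_left h3 h4)
    field_simp
  have hm1 := mul_le_mul_of_nonneg_left hdiv hχ
  simp only [radialCutoff, cutoffSlope, smul_apply, innerSL_apply_apply,
    smul_eq_mul] at *
  nlinarith

theorem norm_testField_le (hx₀ : x₀ ∈ frontier Ω) (ha : 0 < a)
    (hδ : 0 < δ) (hδ1 : δ ≤ 1) (hρ : 0 < ρ) (hρ1 : ρ ≤ 1) (hB : 0 ≤ B)
    (hρa : (1 + δ) * ρ ^ 2 < a ^ 2)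
    (hZn : ∀ x ∈ oneSidedTube Ω a, ‖x - x₀‖ ^ 2 ≤ 2 * ρ ^ 2 → ‖Z x‖ ≤ B * ρ ^ 2)
    {x : Space n} (hx : x ∈ closure Ω) :
    ‖testField x₀ δ ρ Z x‖ ≤ radialCutoff x₀ δ ρ x * ((2 + B) * ρ) := by
  rcases le_or_gt ((1 + δ) * ρ ^ 2) (‖x - x₀‖ ^ 2) with h | h
  · simp [testField, radialCutoff_eq_zero hδ hρ h]
  have hxT : x ∈ oneSidedTube Ω a :=
    mem_oneSidedTube_of_norm_lt hx₀ hx (lt_of_pow_lt_pow_left₀ 2 ha.le (h.trans hρa))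
  have hr2 : ‖x - x₀‖ ^ 2 ≤ 2 * ρ ^ 2 := h.le.trans (by nlinarith)
  rw [testField, norm_smul, Real.norm_of_nonneg (radialCutoff_nonneg _ _ _ _)]
  refine mul_le_mul_of_nonneg_left ((norm_add_le _ _).trans ?_) (cutoff_nonneg _ _)
  have h1 : ‖x - x₀‖ ≤ 2 * ρ :=
    le_of_sq_le_sq (by nlinarith) (by positivity)
  have h2 := hZn x hxT hr2
  nlinarith [mul_nonneg hB hρ.le]

end TestField

/-! ### The first variation tested with the field -/

section FirstVariation

variable {m n : ℕ} {Ω : Set (Space n)} {β : Space n → ℝ}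
  {V Γ : Measure (Space n × Grass m n)} {H : Space n → Space n}

theorem ae_mem_closure (hV : IsCapillaryVarifold Ω β V Γ H) : ∀ᵐ x ∂V.fst, x ∈ closure Ω :=
  hV.varifold_on

theorem ae_fst_mem_closure (hV : IsCapillaryVarifold Ω β V Γ H) :
    ∀ᵐ q ∂V, q.1 ∈ closure Ω :=
  ae_of_ae_map measurable_fst.aemeasurable (ae_mem_closure hV)

theorem ae_mem_frontier (hV : IsCapillaryVarifold Ω β V Γ H) :
    ∀ᵐ x ∂Γ.fst, x ∈ frontier Ω := by
  have h1 : ∀ᵐ q ∂Γ, q ∈ capillaryBundle m Ω β := hV.boundary_on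
  exact (ae_map_iff measurable_fst.aemeasurable isClosed_frontier.measurableSet).2
    (h1.mono fun q hq => hq.1)

theorem integrable_planeDiv (hΩ : IsBoundedC2Domain Ω) (hV : IsCapillaryVarifold Ω β V Γ H)
    {φ : Space n → Space n} (hφ : ContDiffOn ℝ 1 φ (closure Ω)) :
    Integrable (fun q : Space n × Grass m n =>
      planeDiv q.2 (fderivWithin ℝ φ (closure Ω) q.1)) V := by
  have := hV.finite_varifold
  have hc : ContinuousOn (fderivWithin ℝ φ (closure Ω)) (closure Ω) :=
    hφ.continuousOn_fderivWithin (uniqueDiffOn_closure hΩ) (by norm_num)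
  obtain ⟨M, hM⟩ := (isCompact_closure_domain hΩ).exists_bound_of_continuousOn hc
  have hae := ae_fst_mem_closure hV
  -- The derivative within the closure is continuous only there; restricting `V`, which changes
  -- nothing, gives measurability.
  have hres : V.restrict (Prod.fst ⁻¹' closure Ω) = V := Measure.restrict_eq_self_of_ae_mem hae
  refine Integrable.of_bound ?_ ((n + 1) * M) ?_
  · rw [← hres]
    refine ContinuousOn.aestronglyMeasurable ?_ (measurable_fst isClosed_closure.measurableSet)
    refine continuous_planeDiv.comp_continuousOn (continuous_snd.continuousOn.prodMk ?_)
    exact hc.comp continuous_fst.continuousOn fun q hq => hq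
  · filter_upwards [hae] with q hq
    exact (abs_planeDiv_le q.2 _).trans (mul_le_mul_of_nonneg_left (hM _ hq) (by positivity))

theorem norm_planeConormal_le (x : Space n) (P : Grass m n) : ‖planeConormal Ω x P‖ ≤ 1 := by
  rw [planeConormal, norm_smul, norm_inv, norm_norm]
  exact inv_mul_le_one

theorem integrable_planeConormal (κ : Kernel (Space n) (Grass m n)) [IsMarkovKernel κ]
    (x : Space n) : Integrable (fun P => planeConormal Ω x P) (κ x) := by
  refine Integrable.of_bound ?_ 1 (ae_of_all _ fun P => norm_planeConormal_le x P)
  have h : Continuous fun P : Grass m n => P.1 (innerNormal Ω x) :=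
    continuous_subtype_val.clm_apply continuous_const
  exact (h.norm.measurable.inv.smul h.measurable).aestronglyMeasurable

/-- Disintegration turns the inner integral into a product with the averaged conormal. Integrability
need not be checked: otherwise the integral is `0` by convention. -/
theorem boundary_integral_nonneg {κ : Kernel (Space n) (Grass m n)} [IsMarkovKernel κ]
    (hΓf : IsFiniteMeasure Γ) (hκ : Γ.fst.compProd κ = Γ) {φ : Space n → Space n}
    (h : ∀ᵐ x ∂Γ.fst, 0 ≤ inner ℝ (conormal Ω κ x) (φ x)) :
    0 ≤ ∫ q, inner ℝ (planeConormal Ω q.1 q.2) (φ q.1) ∂Γ := by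
  by_cases hi : Integrable (fun q : Space n × Grass m n =>
      inner ℝ (planeConormal Ω q.1 q.2) (φ q.1)) Γ
  · rw [← hκ] at hi ⊢
    rw [Measure.integral_compProd hi]
    refine integral_nonneg_of_ae ?_
    filter_upwards [h] with x hx
    have h1 : ∫ P, inner ℝ (planeConormal Ω x P) (φ x) ∂(κ x)
        = inner ℝ (conormal Ω κ x) (φ x) := by
      rw [real_inner_comm, conormal, ← integral_inner (integrable_planeConormal κ x)]
      simp_rw [real_inner_comm]
    simpa [h1] using hx
  · rw [integral_undef hi]

variable {x₀ : Space n} {a δ ρ B : ℝ} {Z : Space n → Space n}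

theorem integrable_radialCutoff (μ : Measure (Space n)) [IsFiniteMeasure μ] :
    Integrable (radialCutoff x₀ δ ρ) μ := by
  refine Integrable.of_bound (contDiff_radialCutoff x₀ δ ρ).continuous.aestronglyMeasurable 1
    (ae_of_all _ (norm_radialCutoff_le_one _ _ _))

theorem continuous_cutoffSlope : Continuous (cutoffSlope x₀ δ ρ) := by
  have := continuous_deriv_cutoff δ
  unfold cutoffSlope
  fun_prop

theorem integrable_cutoffSlope (μ : Measure (Space n)) [IsFiniteMeasure μ] (hδ : 0 < δ) :
    Integrable (cutoffSlope x₀ δ ρ) μ := by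
  obtain ⟨M, hM⟩ := exists_abs_deriv_cutoff_mul_le hδ
  refine Integrable.of_bound continuous_cutoffSlope.aestronglyMeasurable (2 * M)
    (ae_of_all _ fun x => ?_)
  rw [cutoffSlope, norm_mul, norm_neg, Real.norm_ofNat]
  exact mul_le_mul_of_nonneg_left (hM (‖x - x₀‖ ^ 2 / ρ ^ 2) (by positivity)) (by norm_num)

/-- The interior part of the identity is bounded below pointwise, the boundary integral enters with
a minus sign and is non-negative, and the curvature term is estimated by `‖H‖` times the size of the
field. The integral of `cutoffSlope` is `ρ` times the derivative of the smoothed mass. -/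
theorem smoothMass_inequality (hΩ : IsBoundedC2Domain Ω) (hV : IsCapillaryVarifold Ω β V Γ H)
    (hx₀ : x₀ ∈ frontier Ω) (ha : 0 < a)
    (hδ : 0 < δ) (hδ1 : δ ≤ 1) (hρ : 0 < ρ) (hρ1 : ρ ≤ 1) (hB : 0 ≤ B)
    (hρa : (1 + δ) * ρ ^ 2 < a ^ 2) (hZ : ContDiffOn ℝ 1 Z (oneSidedTube Ω a))
    (hZn : ∀ x ∈ oneSidedTube Ω a, ‖x - x₀‖ ^ 2 ≤ 2 * ρ ^ 2 → ‖Z x‖ ≤ B * ρ ^ 2)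
    (hZd : ∀ x ∈ oneSidedTube Ω a, ‖x - x₀‖ ^ 2 ≤ 2 * ρ ^ 2 →
      ‖fderivWithin ℝ Z (closure Ω) x‖ ≤ B * ρ)
    (htan : ∀ x ∈ frontier Ω, IsTangent Ω x (x - x₀ + Z x))
    {κ : Kernel (Space n) (Grass m n)} [IsMarkovKernel κ] (hκ : Γ.fst.compProd κ = Γ)
    (hbd : ∀ᵐ x ∂Γ.fst, ‖x - x₀‖ ^ 2 < (1 + δ) * ρ ^ 2 →
      0 ≤ inner ℝ (conormal Ω κ x) (x - x₀ + Z x)) :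
    (m - (n + 1) * (B * ρ)) * smoothMass V.fst x₀ δ ρ
      - (1 + B * ρ) * ∫ x, cutoffSlope x₀ δ ρ x ∂V.fst
        ≤ (2 + B) * ρ * ∫ x, ‖H x‖ * radialCutoff x₀ δ ρ x ∂V.fst := by
  have := hV.finite_varifold
  have hfin : IsFiniteMeasure V.fst := by infer_instance
  have hφ := contDiffOn_testField hx₀ ha hδ hρ hρa hZ
  have hfv := hV.first_variation _ hφ (fun x hx => by
    have := htan x hx
    unfold IsTangent at this ⊢
    rw [testField, inner_smul_left, this, mul_zero])
  have hΓ0 : 0 ≤ ∫ q, inner ℝ (planeConormal Ω q.1 q.2) (testField x₀ δ ρ Z q.1) ∂Γ := by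
    refine boundary_integral_nonneg hV.finite_boundary hκ ?_
    filter_upwards [hbd] with x hx
    rcases lt_or_ge (‖x - x₀‖ ^ 2) ((1 + δ) * ρ ^ 2) with h | h
    · rw [testField, inner_smul_right]
      exact mul_nonneg (cutoff_nonneg _ _) (hx h)
    · simp [testField, radialCutoff_eq_zero hδ hρ h]
  have hHi : Integrable (fun x => ‖H x‖ * radialCutoff x₀ δ ρ x) V.fst := by
    refine hV.integrable_curvature.norm.mul_bdd (c := 1)
      (contDiff_radialCutoff x₀ δ ρ).continuous.aestronglyMeasurable (ae_of_all _ (norm_radialCutoff_le_one _ _ _))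
  have hH : |∫ x, inner ℝ (H x) (testField x₀ δ ρ Z x) ∂V.fst|
      ≤ (2 + B) * ρ * ∫ x, ‖H x‖ * radialCutoff x₀ δ ρ x ∂V.fst := by
    rw [← integral_const_mul, ← Real.norm_eq_abs]
    refine norm_integral_le_of_norm_le (hHi.const_mul _) ?_
    filter_upwards [ae_mem_closure hV] with x hx
    refine (norm_inner_le_norm _ _).trans ?_
    have := mul_le_mul_of_nonneg_left
      (norm_testField_le hx₀ ha hδ hδ1 hρ hρ1 hB hρa hZn hx) (norm_nonneg (H x))
    linarith
  have hlow : (m - (n + 1) * (B * ρ)) * smoothMass V.fst x₀ δ ρ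
      - (1 + B * ρ) * ∫ x, cutoffSlope x₀ δ ρ x ∂V.fst
        ≤ firstVariation Ω V (testField x₀ δ ρ Z) := by
    have hi1 : Integrable (fun x => radialCutoff x₀ δ ρ x * (m - (n + 1) * (B * ρ))) V.fst :=
      (integrable_radialCutoff _).mul_const _
    have hi2 : Integrable (fun x => cutoffSlope x₀ δ ρ x * (1 + B * ρ)) V.fst :=
      (integrable_cutoffSlope _ hδ).mul_const _
    have h1 : (m - (n + 1) * (B * ρ)) * smoothMass V.fst x₀ δ ρ
        - (1 + B * ρ) * ∫ x, cutoffSlope x₀ δ ρ x ∂V.fst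
        = ∫ x, (radialCutoff x₀ δ ρ x * (m - (n + 1) * (B * ρ))
          - cutoffSlope x₀ δ ρ x * (1 + B * ρ)) ∂V.fst := by
      rw [integral_sub hi1 hi2, integral_mul_const, integral_mul_const, smoothMass]
      ring
    have hi : Integrable (fun x => radialCutoff x₀ δ ρ x * (m - (n + 1) * (B * ρ))
          - cutoffSlope x₀ δ ρ x * (1 + B * ρ)) (V.map Prod.fst) := hi1.sub hi2
    rw [h1, Measure.fst, integral_map measurable_fst.aemeasurable hi.aestronglyMeasurable]
    refine integral_mono_ae (hi.comp_measurable measurable_fst) (integrable_planeDiv hΩ hV hφ) ?_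
    filter_upwards [ae_fst_mem_closure hV] with q hq
    exact planeDiv_testField_ge hΩ hx₀ ha hδ hδ1 hρ hB hρa hZ hZn hZd hq q.2
  rw [hfv] at hlow
  linarith [(abs_le.1 hH).1]

end FirstVariation

/-! ### The correction field at a capillary boundary point -/

section CapillaryField

variable {n : ℕ} {Ω : Set (Space n)} {A C K k ρ : ℝ} {ξ : Space n → Space n} {x₀ τ : Space n}

/-- The correction that makes `x - x₀ + K τ` tangential along the boundary. -/
noncomputable def tangentialCorrection (Ω : Set (Space n)) (ξ : Space n → Space n)
    (x₀ τ : Space n) (K : ℝ) (x : Space n) : Space n :=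
  K • (τ - inner ℝ τ (innerNormal Ω (ξ x)) • innerNormal Ω (ξ x)) -
    inner ℝ (ξ x - x₀) (innerNormal Ω (ξ x)) • innerNormal Ω (ξ x)

/-- A bound for the tangential correction with `K = k ρ²`. -/
def correctionBound (C k : ℝ) : ℝ := 12 * C + 8 * C ^ 2 + 2 * k + 2 * k * C

theorem correctionBound_nonneg (hC : 0 ≤ C) (hk : 0 ≤ k) : 0 ≤ correctionBound C k := by
  unfold correctionBound; positivity

theorem IsTubeProjection.contDiffOn_normal (hΩ : IsBoundedC2Domain Ω)
    (hξ : IsTubeProjection Ω A C ξ) :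
    ContDiffOn ℝ 1 (fun x => innerNormal Ω (ξ x)) (oneSidedTube Ω A) :=
  (contDiffOn_innerNormal hΩ).comp hξ.contDiffOn hξ.mem

theorem contDiffOn_tangentialCorrection (hΩ : IsBoundedC2Domain Ω)
    (hξ : IsTubeProjection Ω A C ξ) :
    ContDiffOn ℝ 1 (tangentialCorrection Ω ξ x₀ τ K) (oneSidedTube Ω A) := by
  have hN := hξ.contDiffOn_normal hΩ
  have h1 : ContDiffOn ℝ 1 (fun x => inner ℝ τ (innerNormal Ω (ξ x))) (oneSidedTube Ω A) :=
    contDiffOn_const.inner ℝ hN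
  have h2 : ContDiffOn ℝ 1 (fun x => inner ℝ (ξ x - x₀) (innerNormal Ω (ξ x)))
      (oneSidedTube Ω A) := (hξ.contDiffOn.sub contDiffOn_const).inner ℝ hN
  exact ((contDiffOn_const.sub (h1.smul hN)).const_smul K).sub (h2.smul hN)

theorem IsTubeProjection.norm_sub_le (hξ : IsTubeProjection Ω A C ξ) (hx₀ : x₀ ∈ frontier Ω)
    {x : Space n} (hx : x ∈ oneSidedTube Ω A) : ‖ξ x - x₀‖ ≤ 2 * ‖x - x₀‖ := by
  have h1 := hξ.norm_sub x hx
  have h2 := Metric.infDist_le_dist_of_mem (x := x) hx₀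
  rw [dist_eq_norm] at h2
  have h3 := norm_add_le (ξ x - x) (x - x₀)
  rw [sub_add_sub_cancel] at h3
  linarith

/-- The quadratic tangency at `ξ x`, with `‖ξ x - x₀‖² ≤ 4‖x - x₀‖² ≤ 8ρ²`. -/
theorem abs_inner_normal_le (hC : 0 ≤ C) (hξ : IsTubeProjection Ω A C ξ)
    (hquad : ∀ x ∈ frontier Ω, ∀ y ∈ frontier Ω,
      |inner ℝ (y - x) (innerNormal Ω y)| ≤ C * ‖y - x‖ ^ 2)
    (hx₀ : x₀ ∈ frontier Ω) {x : Space n} (hx : x ∈ oneSidedTube Ω A)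
    (hr : ‖x - x₀‖ ^ 2 ≤ 2 * ρ ^ 2) :
    |inner ℝ (ξ x - x₀) (innerNormal Ω (ξ x))| ≤ 8 * C * ρ ^ 2 := by
  refine (hquad x₀ hx₀ _ (hξ.mem x hx)).trans ?_
  have h1 := hξ.norm_sub_le hx₀ hx
  have h2 : ‖ξ x - x₀‖ ^ 2 ≤ 8 * ρ ^ 2 := by
    have := pow_le_pow_left₀ (norm_nonneg _) h1 2
    nlinarith
  nlinarith [mul_le_mul_of_nonneg_left h2 hC]

theorem norm_tangentialCorrection_le (hΩ : IsBoundedC2Domain Ω) (hC : 0 ≤ C) (hk : 0 ≤ k)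
    (hξ : IsTubeProjection Ω A C ξ)
    (hquad : ∀ x ∈ frontier Ω, ∀ y ∈ frontier Ω,
      |inner ℝ (y - x) (innerNormal Ω y)| ≤ C * ‖y - x‖ ^ 2)
    (hx₀ : x₀ ∈ frontier Ω) (hτ : ‖τ‖ = 1) {x : Space n} (hx : x ∈ oneSidedTube Ω A)
    (hr : ‖x - x₀‖ ^ 2 ≤ 2 * ρ ^ 2) :
    ‖tangentialCorrection Ω ξ x₀ τ (k * ρ ^ 2) x‖ ≤ correctionBound C k * ρ ^ 2 := by
  have hN : ‖innerNormal Ω (ξ x)‖ = 1 := norm_innerNormal hΩ (hξ.mem x hx)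
  have h1 := abs_inner_normal_le hC hξ hquad hx₀ hx hr
  have h2 : ‖τ - inner ℝ τ (innerNormal Ω (ξ x)) • innerNormal Ω (ξ x)‖ ≤ 2 := by
    refine (norm_sub_le _ _).trans ?_
    rw [norm_smul, hN, hτ, mul_one]
    have := norm_inner_le_norm (𝕜 := ℝ) τ (innerNormal Ω (ξ x))
    rw [hN, hτ] at this
    linarith
  refine (norm_sub_le _ _).trans ?_
  rw [norm_smul, norm_smul, hN, mul_one, Real.norm_of_nonneg (by positivity : 0 ≤ k * ρ ^ 2)]
  have h3 := mul_le_mul_of_nonneg_left h2 (by positivity : 0 ≤ k * ρ ^ 2)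
  have h4 : 0 ≤ (4 * C + 8 * C ^ 2 + 2 * k * C) * ρ ^ 2 := by positivity
  rw [Real.norm_eq_abs]
  unfold correctionBound
  nlinarith

theorem norm_fderivWithin_tangentialCorrection_le (hΩ : IsBoundedC2Domain Ω) (hC : 0 ≤ C)
    (hk : 0 ≤ k) (hρ : 0 < ρ) (hρ1 : ρ ≤ 1) (hξ : IsTubeProjection Ω A C ξ)
    (hquad : ∀ x ∈ frontier Ω, ∀ y ∈ frontier Ω,
      |inner ℝ (y - x) (innerNormal Ω y)| ≤ C * ‖y - x‖ ^ 2)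
    (hx₀ : x₀ ∈ frontier Ω) (hτ : ‖τ‖ = 1) {x : Space n} (hx : x ∈ oneSidedTube Ω A)
    (hr : ‖x - x₀‖ ^ 2 ≤ 2 * ρ ^ 2) :
    ‖fderivWithin ℝ (tangentialCorrection Ω ξ x₀ τ (k * ρ ^ 2)) (closure Ω) x‖
      ≤ correctionBound C k * ρ := by
  have hN1 : ‖innerNormal Ω (ξ x)‖ = 1 := norm_innerNormal hΩ (hξ.mem x hx)
  have hN := hasFDerivWithinAt_closure hx (hξ.contDiffOn_normal hΩ)
  have hξd := hasFDerivWithinAt_closure hx hξ.contDiffOn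
  have hDN := hξ.norm_fderivWithin x hx
  have hDξ := hξ.inner_fderivWithin x hx
  have hu := (hξd.sub_const x₀).inner ℝ hN
  have hτN := (hasFDerivWithinAt_const τ x (closure Ω)).inner ℝ hN
  have hZ : HasFDerivWithinAt (tangentialCorrection Ω ξ x₀ τ (k * ρ ^ 2)) _ (closure Ω) x :=
    (((hτN.smul hN).const_sub τ).const_smul (k * ρ ^ 2)).sub (hu.smul hN)
  rw [hZ.fderivWithin (uniqueDiffOn_closure hΩ x (hx.1))]
  refine ContinuousLinearMap.opNorm_le_bound _
    (mul_nonneg (correctionBound_nonneg hC hk) hρ.le) fun v => ?_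
  have h1 := abs_inner_normal_le hC hξ hquad hx₀ hx hr
  have h2 : ‖ξ x - x₀‖ ≤ 4 * ρ := by
    have := hξ.norm_sub_le hx₀ hx
    have h3 : ‖x - x₀‖ ≤ 2 * ρ := le_of_sq_le_sq (by nlinarith) (by positivity)
    linarith
  set D := fderivWithin ℝ (fun x => innerNormal Ω (ξ x)) (closure Ω) x with hD
  have hDv : ‖D v‖ ≤ C * ‖v‖ := (D.le_opNorm v).trans
    (mul_le_mul_of_nonneg_right hDN (norm_nonneg v))
  have e1 : |inner ℝ τ (innerNormal Ω (ξ x))| ≤ 1 := by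
    simpa [hN1, hτ] using abs_real_inner_le_norm τ (innerNormal Ω (ξ x))
  have e2 : |inner ℝ τ (D v)| ≤ C * ‖v‖ := by
    have := abs_real_inner_le_norm τ (D v)
    rw [hτ, one_mul] at this
    exact this.trans hDv
  have e3 : |inner ℝ (ξ x - x₀) (D v)| ≤ 4 * ρ * (C * ‖v‖) :=
    (abs_real_inner_le_norm _ _).trans (mul_le_mul h2 hDv (norm_nonneg _) (by positivity))
  have hCv : 0 ≤ C * ‖v‖ := by positivity
  -- This is the derivative without the term `⟨Dξ v, N⟩`, which vanishes because `ξ` maps into `S`.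
  -- Every surviving term carries a factor `ρ` or `ρ²`, and no bound on `Dξ` is needed.
  have key : ‖(k * ρ ^ 2) • (-(inner ℝ τ (innerNormal Ω (ξ x)) • D v +
      inner ℝ τ (D v) • innerNormal Ω (ξ x))) -
      (inner ℝ (ξ x - x₀) (innerNormal Ω (ξ x)) • D v +
        inner ℝ (ξ x - x₀) (D v) • innerNormal Ω (ξ x))‖
      ≤ k * ρ ^ 2 * (1 * (C * ‖v‖) + C * ‖v‖) +
        (8 * C * ρ ^ 2 * (C * ‖v‖) + 4 * ρ * (C * ‖v‖)) := by
    refine (norm_sub_le _ _).trans (add_le_add ?_ ((norm_add_le _ _).trans (add_le_add ?_ ?_)))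
    · rw [norm_smul, norm_neg, Real.norm_of_nonneg (by positivity : 0 ≤ k * ρ ^ 2)]
      refine mul_le_mul_of_nonneg_left ((norm_add_le _ _).trans (add_le_add ?_ ?_))
        (by positivity)
      · rw [norm_smul]; exact mul_le_mul e1 hDv (norm_nonneg _) zero_le_one
      · rw [norm_smul, hN1, mul_one]; exact e2
    · rw [norm_smul]; exact mul_le_mul h1 hDv (norm_nonneg _) (by positivity)
    · rw [norm_smul, hN1, mul_one]; exact e3
  refine (le_of_eq ?_).trans (key.trans ?_)
  · congr 1
    simp [hDξ v]
  · have hρ2 : ρ ^ 2 ≤ ρ := by nlinarith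
    have f1 : k * ρ ^ 2 * (1 * (C * ‖v‖) + C * ‖v‖) ≤ 2 * k * C * ρ * ‖v‖ := by
      have := mul_le_mul_of_nonneg_left hρ2 (by positivity : 0 ≤ 2 * k * (C * ‖v‖))
      nlinarith
    have f2 : 8 * C * ρ ^ 2 * (C * ‖v‖) ≤ 8 * C ^ 2 * ρ * ‖v‖ := by
      have := mul_le_mul_of_nonneg_left hρ2 (by positivity : 0 ≤ 8 * C * (C * ‖v‖))
      nlinarith
    have f3 : 0 ≤ (8 * C + 2 * k) * ρ * ‖v‖ := by positivity
    unfold correctionBound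
    nlinarith

theorem isTangent_tangentialCorrection (hΩ : IsBoundedC2Domain Ω)
    (hξ : IsTubeProjection Ω A C ξ) {x : Space n} (hx : x ∈ frontier Ω) :
    IsTangent Ω x (x - x₀ + tangentialCorrection Ω ξ x₀ τ K x) := by
  have hN : inner ℝ (innerNormal Ω x) (innerNormal Ω x) = (1 : ℝ) := by
    rw [real_inner_self_eq_norm_sq, norm_innerNormal hΩ hx, one_pow]
  simp only [IsTangent, tangentialCorrection, hξ.fix x hx, inner_add_left, inner_sub_left,
    inner_smul_left, conj_trivial, hN]
  ring

/-- On `S` the corrected field is the tangential projection of `x - x₀ + Kτ`, and that projection is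
self-adjoint. The right-hand side holds exactly the two products controlled at a capillary boundary
point. -/
theorem inner_tangentialCorrection (hΩ : IsBoundedC2Domain Ω)
    (hξ : IsTubeProjection Ω A C ξ) {x : Space n} (hx : x ∈ frontier Ω) (w : Space n) :
    inner ℝ w (x - x₀ + tangentialCorrection Ω ξ x₀ τ K x)
      = inner ℝ (x - x₀) (tangentProj Ω x w) + K * inner ℝ (tangentProj Ω x w) τ := by
  have h := norm_innerNormal hΩ hx
  simp only [tangentialCorrection, tangentProj, hξ.fix x hx, inner_add_right, inner_sub_right,
    inner_smul_right, inner_sub_left, inner_smul_left, conj_trivial]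
  rw [real_inner_comm x w, real_inner_comm x₀ w, real_inner_comm τ (innerNormal Ω x)]
  ring

end CapillaryField

/-! ### The sign of the boundary term -/

section CapillaryInequality

variable {m n : ℕ} {Ω : Set (Space n)} {β : Space n → ℝ}
  {V Γ : Measure (Space n × Grass m n)} {H : Space n → Space n}
  {A C δ ρ ε c ρ₀ : ℝ} {ξ : Space n → Space n} {x₀ τ : Space n}

theorem IsCapillaryPoint.smoothMass_inequality (hΩ : IsBoundedC2Domain Ω)
    (hV : IsCapillaryVarifold Ω β V Γ H) (hpt : IsCapillaryPoint Ω β Γ x₀ τ ε c ρ₀)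
    (hC : 0 ≤ C) (hξ : IsTubeProjection Ω A C ξ)
    (hquad : ∀ x ∈ frontier Ω, ∀ y ∈ frontier Ω,
      |inner ℝ (y - x) (innerNormal Ω y)| ≤ C * ‖y - x‖ ^ 2)
    (hA : 0 < A) (hδ : 0 < δ) (hδ1 : δ ≤ 1) (hρ : 0 < ρ)
    (hρA : (1 + δ) * ρ ^ 2 < A ^ 2) (hρρ₀ : (1 + δ) * ρ ^ 2 < ρ₀ ^ 2) :
    (m - (n + 1) * (correctionBound C (2 * (c * |Real.cos (β x₀)|) / ε) * ρ)) *
        smoothMass V.fst x₀ δ ρ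
      - (1 + correctionBound C (2 * (c * |Real.cos (β x₀)|) / ε) * ρ) *
        ∫ x, cutoffSlope x₀ δ ρ x ∂V.fst
      ≤ (2 + correctionBound C (2 * (c * |Real.cos (β x₀)|) / ε)) * ρ *
        ∫ x, ‖H x‖ * radialCutoff x₀ δ ρ x ∂V.fst := by
  -- Chosen so that the gain `kρ²ε` equals `c|cos β(x₀)| · 2ρ²`, the largest loss where `‖x - x₀‖² ≤
  -- 2ρ²`.
  set k := 2 * (c * |Real.cos (β x₀)|) / ε with hkdef
  have hε := hpt.eps_mem.1
  have hk : 0 ≤ k := by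
    have := hpt.const_pos
    positivity
  have hkε : k * ε = 2 * (c * |Real.cos (β x₀)|) := by rw [hkdef]; field_simp
  have hρ1 : ρ ≤ 1 := by
    refine le_of_sq_le_sq ?_ zero_le_one
    have h1 := hpt.radius_mem.1
    have h2 := hpt.radius_mem.2
    nlinarith
  obtain ⟨κ, hκM, hκ, hdir, hquadbd⟩ := hpt.conditions
  refine Capillary.smoothMass_inequality hΩ hV hpt.mem_boundary hA hδ hδ1 hρ hρ1
    (correctionBound_nonneg hC hk) hρA
    (contDiffOn_tangentialCorrection (x₀ := x₀) (τ := τ) (K := k * ρ ^ 2) hΩ hξ)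
    (fun x hx hr => norm_tangentialCorrection_le hΩ hC hk hξ hquad hpt.mem_boundary
      hpt.norm_direction hx hr)
    (fun x hx hr => norm_fderivWithin_tangentialCorrection_le hΩ hC hk hρ hρ1 hξ hquad
      hpt.mem_boundary hpt.norm_direction hx hr)
    (fun x hx => isTangent_tangentialCorrection hΩ hξ hx) hκ ?_
  filter_upwards [hdir, hquadbd, ae_mem_frontier hV] with x h1 h2 hxS hr
  have hmem : x ∈ Metric.closedBall x₀ ρ₀ := by
    rw [Metric.mem_closedBall, dist_eq_norm]
    exact le_of_lt (lt_of_pow_lt_pow_left₀ 2 hpt.radius_mem.1.le (hr.trans hρρ₀))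
  have h1 := h1 hmem
  have h2 := (abs_le.1 (h2 hmem)).1
  -- A vanishing cosine would make the first capillary product `0 < ε`. Hence the cosine cancels and
  -- `cos β 𝐧_W` is the tangential part of `𝐧_V`.
  have hcos : Real.cos (β x) ≠ 0 := by
    intro h0
    rw [h0, zero_smul, inner_zero_left] at h1
    exact absurd hε (not_lt.2 h1)
  rw [boundaryConormal, smul_smul, mul_inv_cancel₀ hcos, one_smul] at h1 h2
  rw [inner_tangentialCorrection hΩ hξ hxS]
  have h3 := mul_le_mul_of_nonneg_left h1 (by positivity : 0 ≤ k * ρ ^ 2)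
  have h4 : 0 ≤ c * |Real.cos (β x₀)| := mul_nonneg hpt.const_pos.le (abs_nonneg _)
  have h5 : ‖x - x₀‖ ^ 2 ≤ 2 * ρ ^ 2 := hr.le.trans (by nlinarith)
  have h6 := mul_le_mul_of_nonneg_left h5 h4
  have h7 : k * ρ ^ 2 * ε = c * |Real.cos (β x₀)| * (2 * ρ ^ 2) := by
    linear_combination ρ ^ 2 * hkε
  linarith

end CapillaryInequality

/-! ### From the differential inequality to monotonicity -/

section Growth

/-- A differential inequality for a mass function `I`, with `D = ρ I'`, makes
`exp (Λ ρ) ((I / ρ^m)^(1/p) + Λ ρ^((p-m)/p))` non-decreasing. -/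
theorem weightedRatio_le_of_differential_inequality {m : ℕ} {p a b Λ ρ₁ ρ₂ : ℝ}
    {I D : ℝ → ℝ} (hp1 : 1 ≤ p) (hmp : (m : ℝ) < p) (hΛ : 0 < Λ) (ha : a ≤ Λ)
    (ha0 : 0 ≤ a) (hb : b ≤ Λ * (p - m)) (hρ₁ : 0 < ρ₁) (h12 : ρ₁ ≤ ρ₂)
    (hI : ∀ ρ ∈ Icc ρ₁ ρ₂, 0 < I ρ)
    (hD : ∀ ρ ∈ Icc ρ₁ ρ₂, HasDerivAt I (D ρ / ρ) ρ)
    (hineq : ∀ ρ ∈ Icc ρ₁ ρ₂, -(a * ρ * I ρ + b * ρ * I ρ ^ (1 - 1 / p)) ≤ D ρ - m * I ρ) :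
    Real.exp (Λ * ρ₁) * ((I ρ₁ / ρ₁ ^ m) ^ (1 / p) + Λ * ρ₁ ^ ((p - m) / p)) ≤
      Real.exp (Λ * ρ₂) * ((I ρ₂ / ρ₂ ^ m) ^ (1 / p) + Λ * ρ₂ ^ ((p - m) / p)) := by
  have hp0 : 0 < p := by linarith
  have hder : ∀ ρ ∈ Icc ρ₁ ρ₂, HasDerivAt
      (fun ρ => Real.exp (Λ * ρ) * ((I ρ / ρ ^ m) ^ (1 / p) + Λ * ρ ^ ((p - m) / p)))
      (Real.exp (Λ * ρ) * Λ * ((I ρ / ρ ^ m) ^ (1 / p) + Λ * ρ ^ ((p - m) / p)) +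
        Real.exp (Λ * ρ) * ((D ρ - m * I ρ) / (ρ ^ m * ρ) * (1 / p) *
          (I ρ / ρ ^ m) ^ (1 / p - 1) +
          Λ * ((p - m) / p * ρ ^ ((p - m) / p - 1)))) ρ := by
    intro ρ hρ
    have hρ0 : 0 < ρ := hρ₁.trans_le hρ.1
    have hF : HasDerivAt (fun ρ => I ρ / ρ ^ m) ((D ρ - m * I ρ) / (ρ ^ m * ρ)) ρ := by
      refine ((hD ρ hρ).div (hasDerivAt_pow m ρ) (by positivity)).congr_deriv ?_
      rcases m with _ | m
      · simp
      · rw [Nat.add_sub_cancel]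
        field_simp
        ring
    have h1 := hF.rpow_const (p := 1 / p)
      (Or.inl (div_pos (hI ρ hρ) (by positivity : 0 < ρ ^ m)).ne')
    have h2 := (Real.hasDerivAt_rpow_const (x := ρ) (p := (p - m) / p)
      (Or.inl hρ0.ne')).const_mul Λ
    have h3 : HasDerivAt (fun ρ => Real.exp (Λ * ρ)) (Real.exp (Λ * ρ) * Λ) ρ := by
      simpa using ((hasDerivAt_id ρ).const_mul Λ).exp
    exact h3.mul (h1.add h2)
  have hmono : MonotoneOn
      (fun ρ => Real.exp (Λ * ρ) * ((I ρ / ρ ^ m) ^ (1 / p) + Λ * ρ ^ ((p - m) / p)))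
      (Icc ρ₁ ρ₂) := by
    refine monotoneOn_of_deriv_nonneg (convex_Icc _ _)
      (fun ρ hρ => (hder ρ hρ).continuousAt.continuousWithinAt)
      (fun ρ hρ => (hder ρ (interior_subset hρ)).differentiableAt.differentiableWithinAt)
      (fun ρ hρ' => ?_)
    have hρ := interior_subset hρ'
    rw [(hder ρ hρ).deriv]
    have hρ0 : 0 < ρ := hρ₁.trans_le hρ.1
    have hI0 := hI ρ hρ
    have hρm : 0 < ρ ^ m := by positivity
    have hF0 : 0 < I ρ / ρ ^ m := div_pos hI0 hρm
    have e1 : I ρ / ρ ^ m * (I ρ / ρ ^ m) ^ (1 / p - 1) = (I ρ / ρ ^ m) ^ (1 / p) := by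
      rw [← Real.rpow_one_add' hF0.le (by rw [add_sub_cancel]; positivity), add_sub_cancel]
    -- Both powers of `I` cancel, leaving `ρ^(-m/p)`: the curvature term becomes a pure power of
    -- `ρ`, integrable at `0` since `p > m`.
    have e2 : I ρ ^ (1 - 1 / p) / ρ ^ m * (I ρ / ρ ^ m) ^ (1 / p - 1)
        = ρ ^ ((p - m) / p - 1) := by
      rw [Real.div_rpow hI0.le hρm.le, ← Real.rpow_natCast ρ m, ← Real.rpow_mul hρ0.le,
        div_mul_div_comm, ← Real.rpow_add hI0, ← Real.rpow_add hρ0]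
      rw [show (1 - 1 / p + (1 / p - 1) : ℝ) = 0 by ring, Real.rpow_zero, one_div,
        ← Real.rpow_neg hρ0.le]
      congr 1
      field_simp
      ring
    have hG : -(a / p * (I ρ / ρ ^ m) ^ (1 / p) + b / p * ρ ^ ((p - m) / p - 1)) ≤
        (D ρ - m * I ρ) / (ρ ^ m * ρ) * (1 / p) * (I ρ / ρ ^ m) ^ (1 / p - 1) := by
      have h1 : -(a * ρ * I ρ + b * ρ * I ρ ^ (1 - 1 / p)) *
          (1 / (ρ ^ m * ρ) * (1 / p) * (I ρ / ρ ^ m) ^ (1 / p - 1)) ≤ (D ρ - m * I ρ) *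
          (1 / (ρ ^ m * ρ) * (1 / p) * (I ρ / ρ ^ m) ^ (1 / p - 1)) :=
        mul_le_mul_of_nonneg_right (hineq ρ hρ) (by positivity)
      refine (le_of_eq ?_).trans (h1.trans (le_of_eq ?_))
      · rw [← e1, ← e2]
        field_simp
      · ring
    have hGp : 0 ≤ (I ρ / ρ ^ m) ^ (1 / p) := by positivity
    have hRp : 0 ≤ ρ ^ ((p - m) / p - 1) := by positivity
    have hRq : 0 ≤ ρ ^ ((p - m) / p) := by positivity
    -- The derivative of the exponential absorbs the error `a`; the derivative of `Λρ^((p-m)/p)`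
    -- absorbs the error `b`.
    have ha' : a / p ≤ Λ := (div_le_self ha0 hp1).trans ha
    have hb' : b / p ≤ Λ * ((p - m) / p) := by
      rw [← mul_div_assoc]; exact div_le_div_of_nonneg_right hb hp0.le
    have h2 := mul_le_mul_of_nonneg_right ha' hGp
    have h3 := mul_le_mul_of_nonneg_right hb' hRp
    have h4 : 0 ≤ Λ * (Λ * ρ ^ ((p - m) / p)) := by positivity
    rw [mul_assoc, ← mul_add]
    refine mul_nonneg (Real.exp_pos _).le ?_
    linarith
  exact hmono (left_mem_Icc.2 h12) (right_mem_Icc.2 h12) h12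

end Growth

/-! ### The smoothed mass: derivative, limit and Hölder bound -/

section SmoothMass

variable {n : ℕ} {μ : Measure (Space n)} [IsFiniteMeasure μ] {x₀ : Space n} {δ ρ : ℝ}

theorem hasDerivAt_smoothMass (hδ : 0 < δ) (hρ : 0 < ρ) :
    HasDerivAt (smoothMass μ x₀ δ) ((∫ x, cutoffSlope x₀ δ ρ x ∂μ) / ρ) ρ := by
  obtain ⟨M, hM⟩ := exists_abs_deriv_cutoff_mul_le hδ
  have hM0 : 0 ≤ M := (abs_nonneg _).trans (hM 0 le_rfl)
  have h := hasDerivAt_integral_of_dominated_loc_of_deriv_le (μ := μ) (x₀ := ρ)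
    (s := Ioi (ρ / 2)) (F := fun ρ x => radialCutoff x₀ δ ρ x)
    (F' := fun ρ x => cutoffSlope x₀ δ ρ x / ρ) (bound := fun _ => 2 * M / (ρ / 2))
    (Ioi_mem_nhds (by linarith))
    (Eventually.of_forall fun ρ => (integrable_radialCutoff μ).aestronglyMeasurable)
    (integrable_radialCutoff μ)
    (continuous_cutoffSlope.div_const _).aestronglyMeasurable
    (ae_of_all _ fun x t ht => ?_) (integrable_const _) (ae_of_all _ fun x t ht => ?_)
  · have h2 := h.2
    rw [integral_div] at h2
    exact h2
  · have ht' : ρ / 2 < t := ht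
    have ht0 : 0 < t := by linarith
    rw [norm_div, Real.norm_of_nonneg ht0.le]
    refine div_le_div₀ (by positivity) ?_ (by positivity) ht'.le
    rw [cutoffSlope, norm_mul, norm_neg, Real.norm_ofNat]
    exact mul_le_mul_of_nonneg_left (hM _ (by positivity)) (by norm_num)
  · have ht' : ρ / 2 < t := ht
    have ht0 : 0 < t := by linarith
    have h1 : HasDerivAt (fun t : ℝ => ‖x - x₀‖ ^ 2 / t ^ 2)
        (-2 * (‖x - x₀‖ ^ 2 / t ^ 2) / t) t := by
      refine ((hasDerivAt_const t (‖x - x₀‖ ^ 2)).div (hasDerivAt_pow 2 t)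
        (by positivity)).congr_deriv ?_
      field_simp
      norm_num
      ring
    refine ((hasDerivAt_cutoff δ _).comp t h1).congr_deriv ?_
    unfold cutoffSlope
    ring

theorem smoothMass_nonneg (μ : Measure (Space n)) (x₀ : Space n) (δ ρ : ℝ) :
    0 ≤ smoothMass μ x₀ δ ρ :=
  integral_nonneg fun x => radialCutoff_nonneg x₀ δ ρ x

theorem smoothMass_mono (hδ : 0 < δ) (hρ : 0 < ρ) {ρ' : ℝ} (h : ρ ≤ ρ') :
    smoothMass μ x₀ δ ρ ≤ smoothMass μ x₀ δ ρ' :=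
  integral_mono (integrable_radialCutoff μ) (integrable_radialCutoff μ) fun x =>
    antitone_cutoff hδ (div_le_div_of_nonneg_left (by positivity) (by positivity)
      (pow_le_pow_left₀ hρ.le h 2))

/-- The cut-off equals `1` for arguments up to and including `1`, so the limit as `δ ↘ 0` is the
mass of the closed ball. -/
theorem tendsto_smoothMass (hρ : 0 < ρ) :
    Tendsto (fun δ => smoothMass μ x₀ δ ρ) (𝓝[>] 0)
      (𝓝 (μ.real (Metric.closedBall x₀ ρ))) := by
  rw [← integral_indicator_one Metric.isClosed_closedBall.measurableSet]
  refine tendsto_integral_filter_of_dominated_convergence (fun _ => 1)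
    (Eventually.of_forall fun δ => (integrable_radialCutoff μ).aestronglyMeasurable)
    (Eventually.of_forall fun δ => ae_of_all _ (norm_radialCutoff_le_one _ _ _))
    (integrable_const _) (ae_of_all _ fun x => ?_)
  have hρ2 : 0 < ρ ^ 2 := by positivity
  by_cases hx : x ∈ Metric.closedBall x₀ ρ
  · rw [indicator_of_mem hx]
    refine tendsto_const_nhds.congr' ?_
    filter_upwards [self_mem_nhdsWithin] with δ hδ
    rw [Metric.mem_closedBall, dist_eq_norm] at hx
    refine (cutoff_eq_one hδ ?_).symm
    rw [div_le_one hρ2]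
    exact pow_le_pow_left₀ (norm_nonneg _) hx 2
  · rw [indicator_of_notMem hx]
    rw [Metric.mem_closedBall, dist_eq_norm, not_le] at hx
    have h1 : 1 < ‖x - x₀‖ ^ 2 / ρ ^ 2 := by
      rw [one_lt_div hρ2]
      exact pow_lt_pow_left₀ hx hρ.le (by norm_num)
    refine tendsto_const_nhds.congr' ?_
    filter_upwards [self_mem_nhdsWithin,
      mem_nhdsWithin_of_mem_nhds (gt_mem_nhds (sub_pos.2 h1))] with δ hδ hδ'
    have hδ'' : δ < ‖x - x₀‖ ^ 2 / ρ ^ 2 - 1 := hδ'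
    exact (cutoff_eq_zero hδ (by linarith)).symm

/-- Hölder, with `η^q ≤ η` for the conjugate exponent `q > 1` because `0 ≤ η ≤ 1`. -/
theorem integral_norm_mul_radialCutoff_le {H : Space n → Space n} {p : ℝ} (hp : 1 < p)
    (hH : MemLp H (ENNReal.ofReal p) μ) :
    ∫ x, ‖H x‖ * radialCutoff x₀ δ ρ x ∂μ ≤
      (eLpNorm H (ENNReal.ofReal p) μ).toReal * smoothMass μ x₀ δ ρ ^ (1 - 1 / p) := by
  have hp0 : 0 < p := by linarith
  have hpq : p.HolderConjugate p.conjExponent := Real.HolderConjugate.conjExponent hp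
  have hq1 : 1 < p.conjExponent := hpq.symm.lt
  have hχ : MemLp (radialCutoff x₀ δ ρ) (ENNReal.ofReal p.conjExponent) μ :=
    MemLp.of_bound (integrable_radialCutoff μ).aestronglyMeasurable 1
      (ae_of_all _ (norm_radialCutoff_le_one _ _ _))
  have h := integral_mul_norm_le_Lp_mul_Lq hpq hH.norm (by simpa using hχ)
  have hJ : (∫ a, ‖‖H a‖‖ ^ p ∂μ) ^ (1 / p) = (eLpNorm H (ENNReal.ofReal p) μ).toReal := by
    rw [hH.eLpNorm_eq_integral_rpow_norm (by simpa using hp0) ENNReal.ofReal_ne_top,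
      ENNReal.toReal_ofReal hp0.le, ENNReal.toReal_ofReal (by positivity)]
    simp
  rw [hJ] at h
  have he : 1 / p.conjExponent = 1 - 1 / p := by
    have := hpq.inv_add_inv_eq_one
    rw [one_div, one_div]
    linarith
  have hpow : ∫ a, ‖radialCutoff x₀ δ ρ a‖ ^ p.conjExponent ∂μ ≤ smoothMass μ x₀ δ ρ := by
    refine integral_mono_of_nonneg (ae_of_all _ fun x => by positivity)
      (integrable_radialCutoff μ) (ae_of_all _ fun x => ?_)
    simp only
    rw [Real.norm_of_nonneg (radialCutoff_nonneg _ _ _ _)]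
    exact Real.rpow_le_self_of_le_one (radialCutoff_nonneg _ _ _ _) (cutoff_le_one _ _) hq1.le
  have h0 : 0 ≤ 1 - 1 / p := by rw [← he]; have := hq1; positivity
  refine (le_of_eq ?_).trans (h.trans (mul_le_mul_of_nonneg_left ?_ ENNReal.toReal_nonneg))
  · refine integral_congr_ae (ae_of_all _ fun x => ?_)
    simp [abs_of_nonneg (radialCutoff_nonneg x₀ δ ρ x)]
  · rw [he]
    exact Real.rpow_le_rpow (integral_nonneg fun x => by positivity) hpow h0

end SmoothMass

/-! ### Consequences of monotonicity for the mass ratio -/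

section Consequences

/-- Bernoulli's inequality for `x / y`, that is, convexity of the power function at `y`. -/
theorem rpow_sub_rpow_le {p x y : ℝ} (hp : 1 ≤ p) (hx : 0 ≤ x) (hy : 0 < y) :
    y ^ p - x ^ p ≤ p * y ^ (p - 1) * (y - x) := by
  have h := one_add_mul_self_le_rpow_one_add (s := x / y - 1)
    (by have : 0 ≤ x / y := by positivity
        linarith) hp
  rw [add_sub_cancel, Real.div_rpow hx hy.le, le_div_iff₀ (by positivity)] at h
  have h1 : y ^ p = y ^ (p - 1) * y := by
    rw [← Real.rpow_add_one hy.ne', sub_add_cancel]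
  have h2 : (1 + p * (x / y - 1)) * y ^ p = y ^ p + p * y ^ (p - 1) * (x - y) := by
    rw [h1]; field_simp
  linarith

variable {f : ℝ → ℝ} {p α Λ R M : ℝ}

theorem exists_limit_monotoneOn_update {q : ℝ → ℝ} (hR : 0 < R) (hq0 : ∀ ρ, 0 < ρ → 0 ≤ q ρ)
    (hq : MonotoneOn q (Ioo 0 R)) :
    ∃ l : ℝ, 0 ≤ l ∧ Tendsto q (𝓝[>] 0) (𝓝 l) ∧ MonotoneOn (Function.update q 0 l) (Ico 0 R) := by
  have hbdd : BddBelow (q '' Ioo 0 R) := ⟨0, by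
    rintro _ ⟨ρ, hρ, rfl⟩; exact hq0 ρ hρ.1⟩
  have hlim : Tendsto q (𝓝[>] 0) (𝓝 (sInf (q '' Ioo 0 R))) :=
    hq.tendsto_nhdsWithin_Ioo_right (nonempty_Ioo.2 hR) hbdd
  refine ⟨sInf (q '' Ioo 0 R), ?_, hlim, ?_⟩
  · exact le_csInf ((nonempty_Ioo.2 hR).image q) (by rintro _ ⟨ρ, hρ, rfl⟩; exact hq0 ρ hρ.1)
  · intro r hr ρ hρ hrρ
    rcases eq_or_lt_of_le hr.1 with h0 | h0
    · rw [← h0, Function.update_self]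
      rcases eq_or_lt_of_le hρ.1 with h0' | h0'
      · rw [← h0', Function.update_self]
      · rw [Function.update_of_ne h0'.ne']
        exact csInf_le hbdd ⟨ρ, ⟨h0', hρ.2⟩, rfl⟩
    · have h0' := h0.trans_le hrρ
      rw [Function.update_of_ne h0.ne', Function.update_of_ne h0'.ne']
      exact hq ⟨h0, hr.2⟩ ⟨h0', hρ.2⟩ hrρ

theorem exists_bound_rpow_of_monotoneOn (hp : 1 < p) (hΛ : 0 < Λ)
    (hf0 : ∀ ρ, 0 < ρ → 0 ≤ f ρ)
    (hmono : MonotoneOn (fun ρ => Real.exp (Λ * ρ) * (f ρ ^ (1 / p) + Λ * ρ ^ α)) (Ioo 0 R))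
    (hM : ∀ ρ, R / 2 ≤ ρ → ρ < R → f ρ ≤ M) (hR : 0 < R) :
    ∃ N : ℝ, 0 ≤ N ∧ ∀ ρ ∈ Ioo 0 R, f ρ ^ (1 / p) ≤ N := by
  have hM0 : 0 ≤ M := (hf0 (R / 2) (by positivity)).trans (hM _ le_rfl (by linarith))
  have hnn : ∀ ρ, 0 < ρ → 0 ≤ f ρ ^ (1 / p) := fun ρ hρ => Real.rpow_nonneg (hf0 ρ hρ) _
  refine ⟨M ^ (1 / p) + Real.exp (Λ * (R / 2)) * (f (R / 2) ^ (1 / p) + Λ * (R / 2) ^ α),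
    ?_, fun ρ hρ => ?_⟩
  · have := hnn (R / 2) (by positivity)
    positivity
  have h0 : 0 ≤ Real.exp (Λ * (R / 2)) * (f (R / 2) ^ (1 / p) + Λ * (R / 2) ^ α) := by
    have := hnn (R / 2) (by positivity)
    positivity
  rcases le_or_gt (R / 2) ρ with h | h
  · have := Real.rpow_le_rpow (hf0 ρ hρ.1) (hM ρ h hρ.2) (by positivity : 0 ≤ 1 / p)
    linarith
  · have h1 := hmono hρ ⟨by linarith, by linarith⟩ h.le
    have h2 : 0 ≤ M ^ (1 / p) := by positivity
    have h3 : f ρ ^ (1 / p) ≤ Real.exp (Λ * ρ) * (f ρ ^ (1 / p) + Λ * ρ ^ α) := by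
      have hρ0 := hρ.1
      have h4 : 0 ≤ Λ * ρ ^ α := by positivity
      have h5 := hnn ρ hρ.1
      have h6 : 1 ≤ Real.exp (Λ * ρ) := Real.one_le_exp (by positivity)
      nlinarith
    exact h3.trans (h1.trans (by simpa using h2))

theorem exists_almost_monotone (hp : 1 < p) (hα : 0 < α) (hΛ : 0 < Λ) (hR : 0 < R)
    (hf0 : ∀ ρ, 0 < ρ → 0 ≤ f ρ)
    (hmono : MonotoneOn (fun ρ => Real.exp (Λ * ρ) * (f ρ ^ (1 / p) + Λ * ρ ^ α)) (Ioo 0 R))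
    (hM : ∀ ρ, R / 2 ≤ ρ → ρ < R → f ρ ≤ M) :
    ∃ g : ℝ → ℝ, MonotoneOn g (Ioi 0) ∧ (∀ ρ : ℝ, 0 < ρ → 0 < g ρ) ∧
      Tendsto g (𝓝[>] 0) (𝓝 0) ∧
      ∀ r ρ : ℝ, 0 < r → r < ρ → ρ < R → f r ≤ f ρ + g ρ := by
  obtain ⟨N, hN0, hN⟩ := exists_bound_rpow_of_monotoneOn hp hΛ hf0 hmono hM hR
  have hp0 : 0 < p := by linarith
  have hp1 : 0 < p - 1 := by linarith
  have hexp : ∀ ρ : ℝ, 0 < ρ → 1 ≤ Real.exp (Λ * ρ) := fun ρ hρ => Real.one_le_exp (by positivity)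
  -- With `F = f^(1/p)` and `a = e^{Λρ}(F(ρ) + Λρ^α)`, monotonicity gives `f(r) ≤ a^p ≤ f(ρ) + p
  -- a^(p-1) (a - F(ρ))`. Replacing `F(ρ)` by its bound `N` makes the excess an explicit increasing
  -- function of `ρ`.
  refine ⟨fun ρ => p * (Real.exp (Λ * ρ) * (N + Λ * ρ ^ α)) ^ (p - 1) *
    ((Real.exp (Λ * ρ) - 1) * N + Real.exp (Λ * ρ) * (Λ * ρ ^ α)), ?_, ?_, ?_, ?_⟩
  · intro r (hr : 0 < r) ρ (hρ : 0 < ρ) hrρ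
    have h1 : r ^ α ≤ ρ ^ α := Real.rpow_le_rpow hr.le hrρ hα.le
    have h2 : Real.exp (Λ * r) ≤ Real.exp (Λ * ρ) := by gcongr
    have h3 := hexp r hr
    have h4 : 0 ≤ Real.exp (Λ * r) - 1 := by linarith
    have h5 : Real.exp (Λ * r) - 1 ≤ Real.exp (Λ * ρ) - 1 := by linarith
    simp only
    gcongr
  · intro ρ hρ
    have h4 : 0 ≤ Real.exp (Λ * ρ) - 1 := by linarith [hexp ρ hρ]
    positivity
  · have hc : Continuous fun ρ : ℝ => p * (Real.exp (Λ * ρ) * (N + Λ * ρ ^ α)) ^ (p - 1) *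
        ((Real.exp (Λ * ρ) - 1) * N + Real.exp (Λ * ρ) * (Λ * ρ ^ α)) := by
      have h1 : Continuous fun ρ : ℝ => ρ ^ α := Real.continuous_rpow_const hα.le
      have h2 : Continuous fun ρ : ℝ => (Real.exp (Λ * ρ) * (N + Λ * ρ ^ α)) ^ (p - 1) :=
        Continuous.rpow_const (by fun_prop) fun _ => Or.inr hp1.le
      fun_prop
    have h0 := (hc.tendsto 0).mono_left (nhdsWithin_le_nhds (s := Ioi (0 : ℝ)))
    simpa [Real.zero_rpow hα.ne'] using h0
  · intro r ρ hr hrρ hρR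
    have hρ : 0 < ρ := hr.trans hrρ
    have hFr : 0 ≤ f r ^ (1 / p) := Real.rpow_nonneg (hf0 r hr) _
    have hF : 0 ≤ f ρ ^ (1 / p) := Real.rpow_nonneg (hf0 ρ hρ) _
    have hFN : f ρ ^ (1 / p) ≤ N := hN ρ ⟨hρ, hρR⟩
    have h1 := hmono ⟨hr, hrρ.trans hρR⟩ ⟨hρ, hρR⟩ hrρ.le
    simp only at h1
    have e1 := hexp ρ hρ
    have e2 := hexp r hr
    set a := Real.exp (Λ * ρ) * (f ρ ^ (1 / p) + Λ * ρ ^ α) with ha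
    have ha0 : 0 < a := by positivity
    have h2 : f r ^ (1 / p) ≤ a := by
      refine le_trans ?_ h1
      have h4 : 0 ≤ Λ * r ^ α := by positivity
      nlinarith
    have hpow : ∀ t, 0 < t → (f t ^ (1 / p)) ^ p = f t := fun t ht => by
      rw [← Real.rpow_mul (hf0 t ht), one_div_mul_cancel hp0.ne', Real.rpow_one]
    have h3 : f r ≤ a ^ p := by
      rw [← hpow r hr]; exact Real.rpow_le_rpow hFr h2 hp0.le
    have h4 := rpow_sub_rpow_le hp.le hF ha0
    rw [hpow ρ hρ] at h4
    have h5 : p * a ^ (p - 1) * (a - f ρ ^ (1 / p)) ≤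
        p * (Real.exp (Λ * ρ) * (N + Λ * ρ ^ α)) ^ (p - 1) *
          ((Real.exp (Λ * ρ) - 1) * N + Real.exp (Λ * ρ) * (Λ * ρ ^ α)) := by
      have h6 : a - f ρ ^ (1 / p) = (Real.exp (Λ * ρ) - 1) * f ρ ^ (1 / p) +
          Real.exp (Λ * ρ) * (Λ * ρ ^ α) := by rw [ha]; ring
      have h7 : 0 ≤ Real.exp (Λ * ρ) - 1 := by linarith
      rw [h6, ha]
      gcongr
    linarith

theorem tendsto_of_tendsto_weighted (hp : 1 < p) (hα : 0 < α)
    (hf0 : ∀ ρ, 0 < ρ → 0 ≤ f ρ) {l : ℝ}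
    (hl : Tendsto (fun ρ => Real.exp (Λ * ρ) * (f ρ ^ (1 / p) + Λ * ρ ^ α)) (𝓝[>] 0) (𝓝 l)) :
    Tendsto f (𝓝[>] 0) (𝓝 (l ^ p)) := by
  have hp0 : 0 < p := by linarith
  have h1 : Continuous fun ρ : ℝ => ρ ^ α := Real.continuous_rpow_const hα.le
  have hc1 : Continuous fun ρ : ℝ => Real.exp (-(Λ * ρ)) := by fun_prop
  have hc2 : Continuous fun ρ : ℝ => Λ * ρ ^ α := by fun_prop
  have t1 := (hc1.tendsto 0).mono_left (nhdsWithin_le_nhds (s := Ioi (0 : ℝ)))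
  have t2 := (hc2.tendsto 0).mono_left (nhdsWithin_le_nhds (s := Ioi (0 : ℝ)))
  have h2 := ((t1.mul hl).sub t2).rpow_const (p := p) (Or.inr hp0.le)
  simp only [mul_zero, neg_zero, Real.exp_zero, one_mul, Real.zero_rpow hα.ne', sub_zero] at h2
  refine h2.congr' ?_
  filter_upwards [self_mem_nhdsWithin] with ρ (hρ : 0 < ρ)
  rw [← mul_assoc, ← Real.exp_add, neg_add_cancel, Real.exp_zero, one_mul, add_sub_cancel_right,
    ← Real.rpow_mul (hf0 ρ hρ), one_div_mul_cancel hp0.ne', Real.rpow_one]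

end Consequences

/-! ### Monotonicity for the varifold -/

section Monotonicity

variable {m n : ℕ} {Ω : Set (Space n)} {β : Space n → ℝ}
  {V Γ : Measure (Space n × Grass m n)} {H : Space n → Space n}
  {p Λ A C ε c ρ₀ : ℝ} {ξ : Space n → Space n} {x₀ τ : Space n}

theorem massRatio_nonneg (V : Measure (Space n × Grass m n)) (x₀ : Space n) {ρ : ℝ}
    (hρ : 0 < ρ) : 0 ≤ massRatio V x₀ ρ :=
  div_nonneg measureReal_nonneg (by positivity)

theorem smoothMassRatio_le (hm : 1 ≤ m) (hp : (m : ℝ) < p) (hΩ : IsBoundedC2Domain Ω)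
    (hV : IsCapillaryVarifold Ω β V Γ H) (hH : MemLp H (ENNReal.ofReal p) V.fst)
    (hpt : IsCapillaryPoint Ω β Γ x₀ τ ε c ρ₀)
    (hC : 0 ≤ C) (hξ : IsTubeProjection Ω A C ξ)
    (hquad : ∀ x ∈ frontier Ω, ∀ y ∈ frontier Ω,
      |inner ℝ (y - x) (innerNormal Ω y)| ≤ C * ‖y - x‖ ^ 2)
    (hA : 0 < A) (hΛ : 0 < Λ)
    (hΛ1 : (n + 1 + m) * correctionBound C (2 * (c * |Real.cos (β x₀)|) / ε) ≤ Λ)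
    (hΛ2 : (2 + correctionBound C (2 * (c * |Real.cos (β x₀)|) / ε)) *
      (eLpNorm H (ENNReal.ofReal p) V.fst).toReal ≤ Λ * (p - m))
    {δ ρ₁ ρ₂ : ℝ} (hδ : 0 < δ) (hδ1 : δ ≤ 1) (hρ₁ : 0 < ρ₁) (h12 : ρ₁ ≤ ρ₂)
    (hρA : (1 + δ) * ρ₂ ^ 2 < A ^ 2) (hρρ₀ : (1 + δ) * ρ₂ ^ 2 < ρ₀ ^ 2) :
    Real.exp (Λ * ρ₁) * ((smoothMass V.fst x₀ δ ρ₁ / ρ₁ ^ m) ^ (1 / p)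
        + Λ * ρ₁ ^ ((p - m) / p)) ≤
      Real.exp (Λ * ρ₂) * ((smoothMass V.fst x₀ δ ρ₂ / ρ₂ ^ m) ^ (1 / p)
        + Λ * ρ₂ ^ ((p - m) / p)) := by
  have := hV.finite_varifold
  have hfin : IsFiniteMeasure V.fst := by infer_instance
  have hm' : (1 : ℝ) ≤ m := by exact_mod_cast hm
  have hp1 : 1 < p := by linarith
  have hρ₂ : 0 < ρ₂ := hρ₁.trans_le h12
  have hB : 0 ≤ correctionBound C (2 * (c * |Real.cos (β x₀)|) / ε) := by
    have h1 := hpt.eps_mem.1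
    have h2 := hpt.const_pos
    exact correctionBound_nonneg hC (by positivity)
  -- The power `1/p` is not differentiable at `0`. If the smoothed mass vanishes at `ρ₁` the claim
  -- is immediate; otherwise it is positive on all of `[ρ₁, ρ₂]`.
  rcases eq_or_lt_of_le (smoothMass_nonneg V.fst x₀ δ ρ₁) with h0 | h0
  · have h2 := smoothMass_nonneg V.fst x₀ δ ρ₂
    have hpm : 0 ≤ (p - m) / p := div_nonneg (by linarith) (by linarith)
    have hpi : (1 / p : ℝ) ≠ 0 := by positivity
    rw [← h0, zero_div, Real.zero_rpow hpi, zero_add]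
    have h3 : 0 ≤ (smoothMass V.fst x₀ δ ρ₂ / ρ₂ ^ m) ^ (1 / p) := by positivity
    have h4 : Λ * ρ₁ ^ ((p - m) / p) ≤ Λ * ρ₂ ^ ((p - m) / p) :=
      mul_le_mul_of_nonneg_left (Real.rpow_le_rpow hρ₁.le h12 hpm) hΛ.le
    refine mul_le_mul (by gcongr) (by linarith) (by positivity) (Real.exp_pos _).le
  set B := correctionBound C (2 * (c * |Real.cos (β x₀)|) / ε)
  set J := (eLpNorm H (ENNReal.ofReal p) V.fst).toReal
  have hJ : 0 ≤ J := ENNReal.toReal_nonneg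
  refine weightedRatio_le_of_differential_inequality (a := (n + 1 + m) * B) (b := (2 + B) * J)
    (D := fun ρ => ∫ x, cutoffSlope x₀ δ ρ x ∂V.fst) hp1.le hp hΛ hΛ1 (by positivity) hΛ2
    hρ₁ h12 (fun ρ hρ => h0.trans_le (smoothMass_mono hδ hρ₁ hρ.1))
    (fun ρ hρ => hasDerivAt_smoothMass hδ (hρ₁.trans_le hρ.1)) fun ρ hρ => ?_
  have hρ0 : 0 < ρ := hρ₁.trans_le hρ.1
  have hsq : (1 + δ) * ρ ^ 2 ≤ (1 + δ) * ρ₂ ^ 2 := by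
    have := pow_le_pow_left₀ hρ0.le hρ.2 2
    nlinarith
  have key := hpt.smoothMass_inequality hΩ hV hC hξ hquad hA hδ hδ1 hρ0
    (hsq.trans_lt hρA) (hsq.trans_lt hρρ₀)
  change (m - (n + 1) * (B * ρ)) * smoothMass V.fst x₀ δ ρ - (1 + B * ρ) * _ ≤
    (2 + B) * ρ * _ at key
  have hhol := integral_norm_mul_radialCutoff_le (x₀ := x₀) (δ := δ) (ρ := ρ) hp1 hH
  change _ ≤ J * _ at hhol
  have hI := smoothMass_nonneg V.fst x₀ δ ρ
  have hIp : 0 ≤ smoothMass V.fst x₀ δ ρ ^ (1 - 1 / p) := Real.rpow_nonneg hI _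
  generalize smoothMass V.fst x₀ δ ρ = I at *
  generalize (∫ x, cutoffSlope x₀ δ ρ x ∂V.fst) = D at *
  generalize I ^ (1 - 1 / p) = P at *
  have h1 := mul_le_mul_of_nonneg_left hhol (by positivity : 0 ≤ (2 + B) * ρ)
  have hBρ : 0 ≤ B * ρ := by positivity
  have hE : 0 ≤ (n + 1 + m) * B * ρ * I + (2 + B) * J * ρ * P := by positivity
  have h2 : -((n + 1 + m) * B * ρ * I + (2 + B) * J * ρ * P) ≤ (1 + B * ρ) * (D - m * I) := by
    linarith
  -- The factor `1 + Bρ ≥ 1` may be dropped because the lower bound is non-positive.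
  by_contra! hlt
  have h3 := mul_lt_mul_of_pos_left hlt (by positivity : 0 < 1 + B * ρ)
  nlinarith [mul_nonneg hBρ hE]

theorem monotoneQuantity_le (hm : 1 ≤ m) (hp : (m : ℝ) < p) (hΩ : IsBoundedC2Domain Ω)
    (hV : IsCapillaryVarifold Ω β V Γ H) (hH : MemLp H (ENNReal.ofReal p) V.fst)
    (hpt : IsCapillaryPoint Ω β Γ x₀ τ ε c ρ₀)
    (hC : 0 ≤ C) (hξ : IsTubeProjection Ω A C ξ)
    (hquad : ∀ x ∈ frontier Ω, ∀ y ∈ frontier Ω,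
      |inner ℝ (y - x) (innerNormal Ω y)| ≤ C * ‖y - x‖ ^ 2)
    (hA : 0 < A) (hΛ : 0 < Λ)
    (hΛ1 : (n + 1 + m) * correctionBound C (2 * (c * |Real.cos (β x₀)|) / ε) ≤ Λ)
    (hΛ2 : (2 + correctionBound C (2 * (c * |Real.cos (β x₀)|) / ε)) *
      (eLpNorm H (ENNReal.ofReal p) V.fst).toReal ≤ Λ * (p - m))
    {ρ₁ ρ₂ : ℝ} (hρ₁ : 0 < ρ₁) (h12 : ρ₁ ≤ ρ₂) (hρA : ρ₂ < A) (hρρ₀ : ρ₂ < ρ₀) :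
    monotoneQuantity V x₀ p Λ ρ₁ ≤ monotoneQuantity V x₀ p Λ ρ₂ := by
  have := hV.finite_varifold
  have hfin : IsFiniteMeasure V.fst := by infer_instance
  have hm' : (1 : ℝ) ≤ m := by exact_mod_cast hm
  have hp0 : 0 < p := by linarith
  have hρ₂ : 0 < ρ₂ := hρ₁.trans_le h12
  have hlim : ∀ ρ, 0 < ρ → Tendsto (fun δ => Real.exp (Λ * ρ) *
      ((smoothMass V.fst x₀ δ ρ / ρ ^ m) ^ (1 / p) + Λ * ρ ^ ((p - m) / p)))
      (𝓝[>] 0) (𝓝 (monotoneQuantity V x₀ p Λ ρ)) := fun ρ hρ =>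
    ((((tendsto_smoothMass hρ).div_const _).rpow_const (Or.inr (by positivity))).add_const
      _).const_mul _
  have hsmall : ∀ t, ρ₂ < t → ∀ᶠ δ : ℝ in 𝓝[>] 0, (1 + δ) * ρ₂ ^ 2 < t ^ 2 := fun t ht => by
    have hc : ContinuousAt (fun δ : ℝ => (1 + δ) * ρ₂ ^ 2) 0 := by fun_prop
    refine (hc.eventually (gt_mem_nhds ?_)).filter_mono nhdsWithin_le_nhds
    simpa using pow_lt_pow_left₀ ht hρ₂.le (by norm_num)
  refine le_of_tendsto_of_tendsto (hlim ρ₁ hρ₁) (hlim ρ₂ hρ₂) ?_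
  filter_upwards [hsmall A hρA, hsmall ρ₀ hρρ₀, self_mem_nhdsWithin,
    mem_nhdsWithin_of_mem_nhds (gt_mem_nhds zero_lt_one)] with δ h1 h2 h3 h4
  exact smoothMassRatio_le hm hp hΩ hV hH hpt hC hξ hquad hA hΛ hΛ1 hΛ2 h3 (le_of_lt h4) hρ₁ h12
    h1 h2

end Monotonicity

end Capillary

/-! ### The three conclusions -/

theorem corollary4p4 (n m : ℕ) (hm : 1 ≤ m) (hmn : m ≤ n) (p : ℝ) (hp : (m : ℝ) < p)
    (Ω : Set (Capillary.Space n)) (hΩ : Capillary.IsBoundedC2Domain Ω) :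
    -- `Λ` is a function of `‖H‖_{L^p(μ_V)}`, `ε₀`, `c₀`, `cos β(x₀)`
    ∃ Λ : ℝ → ℝ → ℝ → ℝ → ℝ, (∀ a b c d : ℝ, 0 < Λ a b c d) ∧
      ∀ (ρS : ℝ) (β : Capillary.Space n → ℝ)
        (V Γ : Measure (Capillary.Space n × Capillary.Grass m n))
        (H : Capillary.Space n → Capillary.Space n)
        (x₀ τ : Capillary.Space n) (ε₀ c₀ ρ₀ : ℝ),
        Capillary.IsTubeRadius Ω ρS →
        Capillary.IsContactAngle Ω β →
        Capillary.IsCapillaryVarifold Ω β V Γ H →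
        MemLp H (ENNReal.ofReal p) V.fst →
        Capillary.IsCapillaryPoint Ω β Γ x₀ τ ε₀ c₀ ρ₀ →
        -- monotonicity on `[0, min {ρ₀, ρS / 2})`, the value at `0` being the limit
        (∃ l : ℝ,
          Tendsto (Capillary.monotoneQuantity V x₀ p
              (Λ (eLpNorm H (ENNReal.ofReal p) V.fst).toReal ε₀ c₀ (Real.cos (β x₀))))
            (𝓝[>] 0) (𝓝 l) ∧
          MonotoneOn
            (Function.update
              (Capillary.monotoneQuantity V x₀ p
                (Λ (eLpNorm H (ENNReal.ofReal p) V.fst).toReal ε₀ c₀ (Real.cos (β x₀))))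
              0 l)
            (Set.Ico 0 (min ρ₀ (ρS / 2)))) ∧
        -- almost monotonicity of the mass ratio
        (∃ g : ℝ → ℝ, MonotoneOn g (Set.Ioi 0) ∧ (∀ ρ : ℝ, 0 < ρ → 0 < g ρ) ∧
          Tendsto g (𝓝[>] 0) (𝓝 0) ∧
          ∀ r ρ : ℝ, 0 < r → r < ρ → ρ < min ρ₀ (ρS / 2) →
            Capillary.massRatio V x₀ r ≤ Capillary.massRatio V x₀ ρ + g ρ) ∧
        -- existence of the `m`-density of `μ_V` at `x₀`
        (∃ θ : ℝ, Tendsto (fun r : ℝ => V.fst.real (Metric.closedBall x₀ r) /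
          (Capillary.unitBallVolume m * r ^ m)) (𝓝[>] 0) (𝓝 θ)) := by
  have hm' : (1 : ℝ) ≤ m := by exact_mod_cast hm
  have hp1 : 1 < p := by linarith
  have hpm : 0 < p - m := by linarith
  by_cases hex : (frontier Ω).Nonempty ∧ ∃ r, Capillary.IsTubeRadius Ω r
  swap
  -- Without boundary points or tube radii the hypotheses cannot be met.
  · exact ⟨fun _ _ _ _ => 1, fun _ _ _ _ => one_pos, fun ρS β V Γ H x₀ τ ε₀ c₀ ρ₀ hρS _ _ _ hpt =>
      absurd ⟨⟨x₀, hpt.mem_boundary⟩, ρS, hρS⟩ hex⟩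
  obtain ⟨C, A, ξ, hC, hξ, hA, hquad⟩ := Capillary.exists_uniform_projection hΩ hex.1 hex.2
  -- The two summands after `1` meet the two lower bounds on `Λ`. Absolute values keep it positive
  -- for all real arguments and leave the `L^p` norm unchanged.
  refine ⟨fun a b c d => 1 + (n + 1 + m) * |Capillary.correctionBound C (2 * (c * |d|) / b)| +
    (2 + |Capillary.correctionBound C (2 * (c * |d|) / b)|) * |a| / (p - m),
    fun a b c d => by positivity, ?_⟩
  intro ρS β V Γ H x₀ τ ε₀ c₀ ρ₀ hρS hβ hV hH hpt
  simp only
  set J := (eLpNorm H (ENNReal.ofReal p) V.fst).toReal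
  set B := Capillary.correctionBound C (2 * (c₀ * |Real.cos (β x₀)|) / ε₀) with hBdef
  set Λ := 1 + (n + 1 + m) * |B| + (2 + |B|) * |J| / (p - m) with hΛdef
  have hfin := hV.finite_varifold
  have hB : B ≤ |B| := le_abs_self B
  have hJ : |J| = J := abs_of_nonneg ENNReal.toReal_nonneg
  have hJ0 : 0 ≤ J := ENNReal.toReal_nonneg
  have hΛ : 0 < Λ := by positivity
  have hΛ1 : (n + 1 + m) * B ≤ Λ := by
    have h1 : (n + 1 + m) * B ≤ (n + 1 + m) * |B| := by gcongr
    have h2 : 0 ≤ (2 + |B|) * |J| / (p - m) := by positivity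
    linarith
  have hΛ2 : (2 + B) * J ≤ Λ * (p - m) := by
    have h1 : (2 + |B|) * |J| / (p - m) ≤ Λ := by
      have : 0 ≤ (n + 1 + m) * |B| := by positivity
      linarith
    rw [div_le_iff₀ hpm, hJ] at h1
    exact (mul_le_mul_of_nonneg_right (by linarith) hJ0).trans h1
  have hR : 0 < min ρ₀ (ρS / 2) := lt_min hpt.radius_mem.1 (half_pos hρS.pos)
  have hA0 : 0 < A := (half_pos hρS.pos).trans_le (hA ρS hρS)
  have hα : 0 < (p - m) / p := by positivity
  have hmono : MonotoneOn (Capillary.monotoneQuantity V x₀ p Λ) (Ioo 0 (min ρ₀ (ρS / 2))) :=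
    fun r hr ρ hρ hrρ => Capillary.monotoneQuantity_le hm hp hΩ hV hH hpt hC hξ hquad hA0 hΛ
      hΛ1 hΛ2 hr.1 hrρ ((hρ.2.trans_le (min_le_right _ _)).trans_le (hA ρS hρS))
      (hρ.2.trans_le (min_le_left _ _))
  have hf0 : ∀ ρ, 0 < ρ → 0 ≤ Capillary.massRatio V x₀ ρ := fun ρ hρ =>
    Capillary.massRatio_nonneg V x₀ hρ
  obtain ⟨l, -, hl, hlmono⟩ := Capillary.exists_limit_monotoneOn_update hR (fun ρ hρ => by
    have h1 := hf0 ρ hρ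
    unfold Capillary.monotoneQuantity
    positivity) hmono
  refine ⟨⟨l, hl, hlmono⟩, ?_, ?_⟩
  · refine Capillary.exists_almost_monotone (f := Capillary.massRatio V x₀)
      (M := V.fst.real univ / (min ρ₀ (ρS / 2) / 2) ^ m) hp1 hα hΛ hR hf0 hmono
      fun ρ h1 _ => ?_
    unfold Capillary.massRatio
    gcongr
    exacts [measure_ne_top _ _, subset_univ _]
  · refine ⟨l ^ p / Capillary.unitBallVolume m, ?_⟩
    refine ((Capillary.tendsto_of_tendsto_weighted hp1 hα hf0 hl).div_const
      (Capillary.unitBallVolume m)).congr fun ρ => ?_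
    unfold Capillary.massRatio
    rw [div_div, mul_comm]
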